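/- **Proposition (blob operators and the canonical group).** Let $\hbar>0$, let $X,Y$ be real symmetric $n\times n$ matrices with $X$ positive definite, and let $\psi_{XY}\in L^2(\mathbb{R}^n)$ be the Gaussian $$\psi_{XY}(x)=\Big(\frac{\det X}{(\pi\hbar)^n}\Big)^{1/4}e^{-\frac{1}{2\hbar}(X+iY)x\cdot x}.$$ For $z_0=(x_0,p_0)\in\mathbb{R}^{2n}$ let $\widehat T(z_0)\psi(x)=e^{\frac{i}{\hbar}(p_0\cdot x-\frac12 p_0\cdot x_0)}\psi(x-x_0)$. The blob operator with symbol $a$ is the Toeplitz operator with window $\psi_{XY}$, $$\operatorname{Op}_{\mathrm{TO}}^{\psi_{XY}}(a)\psi=\Big(\frac{1}{2\pi\hbar}\Big)^{n}\int_{\mathbb{R}^{2n}}a(z)\,(\psi|\widehat T(z)\psi_{XY})_{L^2}\,\widehat T(z)\psi_{XY}\,dz,\qquad \psi\in L^2(\mathbb{R}^n),$$ where $(\psi|\phi)_{L^2}=\int\psi\overline{\phi}\,dx$. The Feichtinger algebra $S_0(\mathbb{R}^d)$ is the set of $a\in L^2(\mathbb{R}^d)$ whose Wigner transform $Wa(x,p)=(\frac{1}{2\pi\hbar})^d\int_{\mathbb{R}^d}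 e^{-\frac{i}{\hbar}p\cdot y}a(x+\frac12y)\overline{a(x-\frac12y)}\,dy$ is in $L^1(\mathbb{R}^{2d})$. The canonical group $(S_t^{XY})_{t\in\mathbb{R}}$ of $\psi_{XY}$ is the flow in $\operatorname{Sp}(n)$ of the quadratic Hamiltonian $H_{XY}(x,p)=\frac12\big((p+Yx)^2+X^2x\cdot x\big)$, that is $S_t^{XY}=e^{tJM}$ with $J=\begin{pmatrix}0&I\\-I&0\end{pmatrix}$ and $M=\begin{pmatrix}X^2+Y^2&Y\\Y&I\end{pmatrix}$. The metaplectic group $\operatorname{Mp}(n)$ is the group of unitary operators on $L^2(\mathbb{R}^n)$ generated by $$\widehat J\psi(x)=\Big(\frac{1}{2\pi i\hbar}\Big)^{n/2}\!\int_{\mathbb{R}^n} e^{-\frac{i}{\hbar}x\cdot x'}\psi(x')dx',\quad \widehat V_P\psi(x)=e^{-\frac{i}{2\hbar}Px\cdot x}\psi(x),\quad \widehat M_{L,m}\psi(x)=i^m\sqrt{|\det L|}\,\psi(Lx)$$ ($P$ real symmetric, $L\in GL(n,\mathbb{R})$, $m\in\mathbb{Z}$ with $(-1)^m\det L>0$),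 with covering homomorphism $\pi:\operatorname{Mp}(n)\to\operatorname{Sp}(n)$ sending these to $J$, $\begin{pmatrix}I&0\\-P&I\end{pmatrix}$ and $\begin{pmatrix}L^{-1}&0\\0&L^T\end{pmatrix}$ respectively. Then there is a strongly continuous one-parameter subgroup $(\widehat S_t^{XY})$ of $\operatorname{Mp}(n)$ covering $(S_t^{XY})$, i.e. $\pi(\widehat S_t^{XY})=S_t^{XY}$ for all $t$; and for every such subgroup, every $a\in S_0(\mathbb{R}^{2n})$ and every $t\in\mathbb{R}$: $a\circ S_t^{XY}\in S_0(\mathbb{R}^{2n})$, the integrals defining $\operatorname{Op}_{\mathrm{TO}}^{\psi_{XY}}(a)\psi$ and $\operatorname{Op}_{\mathrm{TO}}^{\psi_{XY}}(a\circ S_t^{XY})\psi$ converge absolutely in $L^2(\mathbb{R}^n)$ for every $\psi\in L^2(\mathbb{R}^n)$, and $$\operatorname{Op}_{\mathrm{TO}}^{\psi_{XY}}(a)=\widehat S_t^{XY}\operatorname{Op}_{\mathrm{TO}}^{\psi_{XY}}(a\circ S_t^{XY})\widehat S_{-t}^{XY}.$$ -/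

import Mathlib

open MeasureTheory

namespace BlobQuantization

noncomputable section

/-- Configuration space `ℝⁿ` (coordinates indexed by `ι`). -/
abbrev Config (ι : Type*) : Type _ := EuclideanSpace ℝ ι

/-- Phase space `ℝ²ⁿ`: `Sum.inl` indexes the positions `x`, `Sum.inr` the momenta `p`. -/
abbrev Phase (ι : Type*) : Type _ := EuclideanSpace ℝ (ι ⊕ ι)

/-- The Hilbert space `L²(ℝⁿ)` of complex square integrable functions. -/
abbrev L2 (ι : Type*) [Fintype ι] : Type _ := Lp ℂ 2 (volume : Measure (Config ι))

/-- The group of unitary operators of `L²(ℝⁿ)`; multiplication is composition. -/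
abbrev Unitaries (ι : Type*) [Fintype ι] : Type _ := L2 ι ≃ₗᵢ[ℂ] L2 ι

variable {ι : Type*} [Fintype ι]

/-- The position part `x` of `z = (x, p)`. -/
def pos (z : Phase ι) : Config ι := WithLp.toLp 2 fun i => z (Sum.inl i)

/-- The momentum part `p` of `z = (x, p)`. -/
def mom (z : Phase ι) : Config ι := WithLp.toLp 2 fun i => z (Sum.inr i)

/-- A square matrix acting on column vectors. -/
def act {κ : Type*} [Fintype κ] (A : Matrix κ κ ℝ) (v : EuclideanSpace ℝ κ) :
    EuclideanSpace ℝ κ := WithLp.toLp 2 (A.mulVec v.ofLp)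

/-! ### Heisenberg displacements and Toeplitz operators -/

/-- `(T̂(z₀)φ)(x) = exp((i/ħ)(p₀·x - p₀·x₀/2)) φ(x - x₀)`, on functions. -/
def displaceFun (ħ : ℝ) (z₀ : Phase ι) (φ : Config ι → ℂ) (x : Config ι) : ℂ :=
  Complex.exp (Complex.I / ħ * ((inner ℝ (mom z₀) x - inner ℝ (mom z₀) (pos z₀) / 2 : ℝ) : ℂ)) *
    φ (x - pos z₀)

theorem memLp_displaceFun (ħ : ℝ) (z₀ : Phase ι) {φ : Config ι → ℂ} (hφ : MemLp φ 2 volume) :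
    MemLp (displaceFun ħ z₀ φ) 2 volume := by
  have h1 : MemLp (fun x => φ (x - pos z₀)) 2 volume :=
    hφ.comp_measurePreserving (measurePreserving_sub_right volume (pos z₀))
  refine MemLp.of_le h1 ?_ (Filter.Eventually.of_forall fun x => ?_)
  · refine AEStronglyMeasurable.mul (Continuous.aestronglyMeasurable ?_) h1.1
    fun_prop
  · have h2 : Complex.I / (ħ : ℂ) * ((inner ℝ (mom z₀) x - inner ℝ (mom z₀) (pos z₀) / 2 : ℝ) : ℂ)
        = (((inner ℝ (mom z₀) x - inner ℝ (mom z₀) (pos z₀) / 2) / ħ : ℝ) : ℂ) * Complex.I := by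
      push_cast; ring
    rw [displaceFun, norm_mul, h2, Complex.norm_exp_ofReal_mul_I, one_mul]

/-- The Heisenberg displacement operator `T̂(z₀)` on `L²(ℝⁿ)`. -/
def displace (ħ : ℝ) (z₀ : Phase ι) (φ : L2 ι) : L2 ι :=
  (memLp_displaceFun ħ z₀ (Lp.memLp φ)).toLp (displaceFun ħ z₀ φ)

/-- The integrand `a(z) (ψ|φ_z) φ_z`, `φ_z = T̂(z)φ`, with `(ψ|φ) = ∫ ψ φ̄`
(Mathlib's `inner` is antilinear in its first argument). -/
def toeplitzIntegrand (ħ : ℝ) (φ : L2 ι) (a : Phase ι → ℂ) (ψ : L2 ι) (z : Phase ι) : L2 ι :=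
  (a z * inner ℂ (displace ħ z φ) ψ) • displace ħ z φ

/-- The Toeplitz operator `Op_TO^φ(a)` with window `φ` and symbol `a`,
`ψ ↦ (2πħ)⁻ⁿ ∫ a(z) (ψ|φ_z) φ_z dz`, as an `L²(ℝⁿ)`-valued Bochner integral. -/
def toeplitz (ħ : ℝ) (φ : L2 ι) (a : Phase ι → ℂ) (ψ : L2 ι) : L2 ι :=
  ((1 / (2 * Real.pi * ħ)) ^ Fintype.card ι : ℝ) • ∫ z, toeplitzIntegrand ħ φ a ψ z

/-! ### The Wigner transform and the Feichtinger algebra -/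

/-- The Wigner transform
`Wψ(x, p) = (2πħ)⁻ᵈ ∫ exp(-(i/ħ) p·y) ψ(x + y/2) conj(ψ(x - y/2)) dy` on `ℝᵈ`. -/
def wigner {κ : Type*} [Fintype κ] (ħ : ℝ) (ψ : EuclideanSpace ℝ κ → ℂ)
    (z : EuclideanSpace ℝ (κ ⊕ κ)) : ℂ :=
  (((1 / (2 * Real.pi * ħ)) ^ Fintype.card κ : ℝ) : ℂ) *
    ∫ y : EuclideanSpace ℝ κ,
      Complex.exp (-(Complex.I / ħ) * ((inner ℝ (mom z) y : ℝ) : ℂ)) *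
        ψ (pos z + (1 / 2 : ℝ) • y) * (starRingEnd ℂ) (ψ (pos z - (1 / 2 : ℝ) • y))

/-- Membership in the Feichtinger algebra `S₀(ℝᵈ)`: `ψ ∈ L²` and `Wψ ∈ L¹`. -/
def MemFeichtinger {κ : Type*} [Fintype κ] (ħ : ℝ) (ψ : EuclideanSpace ℝ κ → ℂ) : Prop :=
  MemLp ψ 2 volume ∧ Integrable (wigner ħ ψ) volume

/-! ### Generalized Gaussians -/

/-- `ψ_XY(x) = (det X / (πħ)ⁿ)^{1/4} exp(-(X + iY)x·x / (2ħ))`. -/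
def gaussianFun [DecidableEq ι] (ħ : ℝ) (X Y : Matrix ι ι ℝ) (x : Config ι) : ℂ :=
  (((X.det / (Real.pi * ħ) ^ Fintype.card ι) ^ (1 / 4 : ℝ) : ℝ) : ℂ) *
    Complex.exp (-(1 / (2 * ħ)) *
      (((inner ℝ (act X x) x : ℝ) : ℂ) + Complex.I * ((inner ℝ (act Y x) x : ℝ) : ℂ)))

theorem continuous_act {κ : Type*} [Fintype κ] (A : Matrix κ κ ℝ) : Continuous (act A) := by
  unfold act
  exact (PiLp.continuous_toLp 2 _).comp
    (Continuous.matrix_mulVec continuous_const (PiLp.continuous_ofLp 2 _))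

theorem act_smul {κ : Type*} [Fintype κ] (A : Matrix κ κ ℝ) (c : ℝ) (v : EuclideanSpace ℝ κ) :
    act A (c • v) = c • act A v := by
  simp [act, Matrix.mulVec_smul]

theorem inner_act {κ : Type*} [Fintype κ] (A : Matrix κ κ ℝ) (v w : EuclideanSpace ℝ κ) :
    inner ℝ (act A v) w = dotProduct w.ofLp (A.mulVec v.ofLp) := by
  simp [act, EuclideanSpace.inner_eq_star_dotProduct]

/-- A positive definite matrix is bounded below by a positive multiple of the identity. -/
theorem exists_lower_bound {X : Matrix ι ι ℝ} (hX : X.PosDef) :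
    ∃ c : ℝ, 0 < c ∧ ∀ x : Config ι, c * ‖x‖ ^ 2 ≤ inner ℝ (act X x) x := by
  have hc : Continuous fun x : Config ι => (inner ℝ (act X x) x : ℝ) :=
    (continuous_act X).inner continuous_id
  rcases (Metric.sphere (0 : Config ι) 1).eq_empty_or_nonempty with he | hne
  · refine ⟨1, one_pos, fun x => ?_⟩
    have hx : x = 0 := by
      by_contra hx
      have : (‖x‖⁻¹ • x) ∈ Metric.sphere (0 : Config ι) 1 := by
        simp [norm_smul, hx]
      rw [he] at this
      exact this
    simp [hx]
  · obtain ⟨u, hu, hmin⟩ := (isCompact_sphere (0 : Config ι) 1).exists_isMinOn hne hc.continuousOn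
    have hu0 : u ≠ 0 := by
      rintro rfl
      simp at hu
    refine ⟨inner ℝ (act X u) u, ?_, fun x => ?_⟩
    · rw [inner_act]
      have h := hX.dotProduct_mulVec_pos (x := u.ofLp) (by simpa using hu0)
      simpa using h
    · by_cases hx : x = 0
      · simp [hx]
      · have h1 : (‖x‖⁻¹ • x) ∈ Metric.sphere (0 : Config ι) 1 := by simp [norm_smul, hx]
        have h2 : inner ℝ (act X u) u ≤ inner ℝ (act X (‖x‖⁻¹ • x)) (‖x‖⁻¹ • x) := hmin h1
        rw [act_smul, inner_smul_left, inner_smul_right] at h2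
        have hp : 0 < ‖x‖ := norm_pos_iff.mpr hx
        calc inner ℝ (act X u) u * ‖x‖ ^ 2
            ≤ (‖x‖⁻¹ * (‖x‖⁻¹ * inner ℝ (act X x) x)) * ‖x‖ ^ 2 := by
              gcongr
              simpa using h2
          _ = inner ℝ (act X x) x := by field_simp

theorem memLp_gaussianFun [DecidableEq ι] {ħ : ℝ} (hħ : 0 < ħ) {X : Matrix ι ι ℝ} (hX : X.PosDef)
    (Y : Matrix ι ι ℝ) : MemLp (gaussianFun ħ X Y) 2 volume := by
  obtain ⟨c, hc, hle⟩ := exists_lower_bound hX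
  have hcX := continuous_act X
  have hcY := continuous_act Y
  have hmeas : AEStronglyMeasurable (gaussianFun ħ X Y) volume := by
    refine Continuous.aestronglyMeasurable ?_
    unfold gaussianFun
    fun_prop
  rw [memLp_two_iff_integrable_sq_norm hmeas]
  have hb : 0 < ((c / ħ : ℝ) : ℂ).re := by simpa using div_pos hc hħ
  have hint := ((GaussianFourier.integrable_cexp_neg_mul_sq_norm_add hb 0
    (0 : Config ι)).norm).const_mul
      (((X.det / (Real.pi * ħ) ^ Fintype.card ι) ^ (1 / 4 : ℝ)) ^ 2)
  refine hint.mono' (hmeas.norm.pow 2) (Filter.Eventually.of_forall fun x => ?_)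
  have e1 : (-(1 / (2 * (ħ : ℂ))) *
      (((inner ℝ (act X x) x : ℝ) : ℂ) + Complex.I * ((inner ℝ (act Y x) x : ℝ) : ℂ))).re
      = -(1 / (2 * ħ)) * inner ℝ (act X x) x := by
    have : (-(1 / (2 * (ħ : ℂ)))) = ((-(1 / (2 * ħ)) : ℝ) : ℂ) := by push_cast; ring
    rw [this, Complex.re_ofReal_mul]
    simp
  have e2 : (-((c / ħ : ℝ) : ℂ) * (‖x‖ : ℂ) ^ 2 + 0 * ((inner ℝ (0 : Config ι) x : ℝ) : ℂ)).re
      = -(c / ħ) * ‖x‖ ^ 2 := by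
    have : (-((c / ħ : ℝ) : ℂ) * (‖x‖ : ℂ) ^ 2 + 0 * ((inner ℝ (0 : Config ι) x : ℝ) : ℂ))
        = ((-(c / ħ) * ‖x‖ ^ 2 : ℝ) : ℂ) := by push_cast; ring
    rw [this, Complex.ofReal_re]
  rw [Real.norm_of_nonneg (by positivity), gaussianFun, norm_mul, mul_pow, Complex.norm_real,
    Real.norm_eq_abs, sq_abs, Complex.norm_exp, Complex.norm_exp, e1, e2, ← Real.exp_nat_mul]
  refine mul_le_mul_of_nonneg_left (Real.exp_le_exp.mpr ?_) (sq_nonneg _)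
  have h := div_le_div_of_nonneg_right (hle x) hħ.le
  have e3 : ((2 : ℕ) : ℝ) * (-(1 / (2 * ħ)) * inner ℝ (act X x) x)
      = -(inner ℝ (act X x) x / ħ) := by
    push_cast; field_simp
  have e4 : -(c / ħ) * ‖x‖ ^ 2 = -(c * ‖x‖ ^ 2 / ħ) := by ring
  rw [e3, e4]
  linarith

/-- The Gaussian `ψ_XY` as an element of `L²(ℝⁿ)`. -/
def gaussian [DecidableEq ι] {ħ : ℝ} (hħ : 0 < ħ) {X : Matrix ι ι ℝ} (hX : X.PosDef) (Y : Matrix ι ι ℝ) : L2 ι :=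
  (memLp_gaussianFun hħ hX Y).toLp (gaussianFun ħ X Y)

/-! ### The canonical group -/

/-- The standard symplectic matrix `J = (0 I; -I 0)`; Hamilton's equations are `ż = J ∇H(z)`. -/
def stdJ (ι : Type*) [DecidableEq ι] : Matrix (ι ⊕ ι) (ι ⊕ ι) ℝ := Matrix.fromBlocks 0 1 (-1) 0

/-- The Hamiltonian `H_XY(x, p) = ((p + Yx)² + X²x·x) / 2`. -/
def hamiltonian (X Y : Matrix ι ι ℝ) (z : Phase ι) : ℝ :=
  (‖mom z + act Y (pos z)‖ ^ 2 + inner ℝ (act (X * X) (pos z)) (pos z)) / 2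

/-- The matrix of `H_XY`, that is `H_XY(z) = M_XY z·z / 2`. -/
def hamiltonianMatrix [DecidableEq ι] (X Y : Matrix ι ι ℝ) : Matrix (ι ⊕ ι) (ι ⊕ ι) ℝ :=
  Matrix.fromBlocks (X * X + Y * Y) Y Y 1

theorem exp_mem_symplectic [DecidableEq ι] {X Y : Matrix ι ι ℝ} (hX : X.IsSymm) (hY : Y.IsSymm) (t : ℝ) :
    NormedSpace.exp (t • (stdJ ι * hamiltonianMatrix X Y)) ∈ Matrix.symplecticGroup ι ℝ := by
  set A := t • (stdJ ι * hamiltonianMatrix X Y) with hA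
  have hJ : Matrix.J ι ℝ = -stdJ ι := by
    simp [Matrix.J, stdJ, Matrix.fromBlocks_neg]
  have hJ2 : stdJ ι * stdJ ι = -1 := by
    simp [stdJ, Matrix.fromBlocks_multiply, ← Matrix.fromBlocks_one, Matrix.fromBlocks_neg]
  have hJt : (stdJ ι).transpose = -stdJ ι := by
    simp [stdJ, Matrix.fromBlocks_transpose, Matrix.fromBlocks_neg]
  have hM : (hamiltonianMatrix X Y).transpose = hamiltonianMatrix X Y := by
    simp [hamiltonianMatrix, Matrix.fromBlocks_transpose, hX.eq, hY.eq]
  have hJJ : stdJ ι * -stdJ ι = 1 := by rw [mul_neg, hJ2, neg_neg]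
  have hinv : (stdJ ι)⁻¹ = -stdJ ι := Matrix.inv_eq_right_inv hJJ
  have hunit : IsUnit (stdJ ι) := by
    rw [Matrix.isUnit_iff_isUnit_det]
    exact Matrix.isUnit_det_of_right_inverse hJJ
  have hAt : A.transpose = -(stdJ ι * A * (stdJ ι)⁻¹) := by
    rw [hinv, hA, Matrix.transpose_smul, Matrix.transpose_mul, hM, hJt, mul_smul_comm,
      smul_mul_assoc, ← smul_neg, ← mul_assoc, hJ2]
    simp
  have hE : (NormedSpace.exp A).transpose
      = stdJ ι * (NormedSpace.exp A)⁻¹ * (stdJ ι)⁻¹ := by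
    rw [← Matrix.exp_transpose, hAt, ← Matrix.exp_neg, ← Matrix.exp_conj _ _ hunit]
    simp
  have hdet : IsUnit (NormedSpace.exp A).det :=
    (Matrix.isUnit_iff_isUnit_det _).mp (Matrix.isUnit_exp A)
  rw [SymplecticGroup.mem_iff', hJ, hE, hinv]
  have h3 : stdJ ι * (NormedSpace.exp A)⁻¹ * -stdJ ι * -stdJ ι * NormedSpace.exp A
      = stdJ ι * (NormedSpace.exp A)⁻¹ * (stdJ ι * stdJ ι) * NormedSpace.exp A := by
    simp [mul_assoc]
  rw [h3, hJ2]
  simp [mul_assoc, Matrix.nonsing_inv_mul _ hdet]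

/-- The canonical group of `ψ_XY`: the flow `S_t = exp(t J M_XY)` of the Hamiltonian `H_XY`
(see `canonicalGroup_zero` and `hasDerivAt_canonicalGroup`), as elements of `Sp(n)`. -/
def canonicalGroup [DecidableEq ι] {X Y : Matrix ι ι ℝ} (hX : X.IsSymm) (hY : Y.IsSymm) (t : ℝ) :
    Matrix.symplecticGroup ι ℝ :=
  ⟨NormedSpace.exp (t • (stdJ ι * hamiltonianMatrix X Y)), exp_mem_symplectic hX hY t⟩

theorem inner_act_comm {κ : Type*} [Fintype κ] {A : Matrix κ κ ℝ} (hA : A.IsSymm)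
    (v w : EuclideanSpace ℝ κ) : inner ℝ (act A v) w = inner ℝ (act A w) v := by
  rw [inner_act, inner_act, Matrix.dotProduct_mulVec, ← Matrix.mulVec_transpose, hA.eq,
    dotProduct_comm]

theorem hamiltonian_eq [DecidableEq ι] (X : Matrix ι ι ℝ) {Y : Matrix ι ι ℝ} (hY : Y.IsSymm)
    (z : Phase ι) :
    hamiltonian X Y z = inner ℝ (act (hamiltonianMatrix X Y) z) z / 2 := by
  have hz : z.ofLp = Sum.elim (pos z).ofLp (mom z).ofLp := by
    ext i
    cases i <;> rfl
  have hsq : ∀ v : Config ι, ‖v‖ ^ 2 = dotProduct v.ofLp v.ofLp := fun v => by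
    rw [← real_inner_self_eq_norm_sq, EuclideanSpace.inner_eq_star_dotProduct]
    simp
  have hyx : dotProduct (mom z).ofLp (Y.mulVec (pos z).ofLp)
      = dotProduct (pos z).ofLp (Y.mulVec (mom z).ofLp) := by
    rw [← inner_act, ← inner_act, inner_act_comm hY]
  have hyy : dotProduct (Y.mulVec (pos z).ofLp) (Y.mulVec (pos z).ofLp)
      = dotProduct (pos z).ofLp (Y.mulVec (Y.mulVec (pos z).ofLp)) := by
    have h := inner_act_comm hY (act Y (pos z)) (pos z)
    rw [inner_act, inner_act] at h
    exact h.symm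
  rw [inner_act (hamiltonianMatrix X Y), hamiltonianMatrix, hz, Matrix.fromBlocks_mulVec,
    hamiltonian, hsq, inner_act]
  simp only [act, WithLp.ofLp_add, Sum.elim_comp_inl, Sum.elim_comp_inr,
    sumElim_dotProduct_sumElim, Matrix.one_mulVec, Matrix.add_mulVec, add_dotProduct,
    dotProduct_add, ← Matrix.mulVec_mulVec, hyy, hyx,
    dotProduct_comm (Y.mulVec (pos z).ofLp) (mom z).ofLp]
  ring

theorem hasGradientAt_hamiltonian [DecidableEq ι] {X Y : Matrix ι ι ℝ} (hX : X.IsSymm)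
    (hY : Y.IsSymm) (z : Phase ι) :
    HasGradientAt (hamiltonian X Y) (act (hamiltonianMatrix X Y) z) z := by
  have hM : (hamiltonianMatrix X Y).IsSymm := by
    simp [Matrix.IsSymm, hamiltonianMatrix, Matrix.fromBlocks_transpose, hX.eq, hY.eq]
  have h1 : HasFDerivAt (fun w : Phase ι => act (hamiltonianMatrix X Y) w)
      (Matrix.toEuclideanLin (hamiltonianMatrix X Y)).toContinuousLinearMap z :=
    (Matrix.toEuclideanLin (hamiltonianMatrix X Y)).toContinuousLinearMap.hasFDerivAt
  have h2 := (h1.inner ℝ (hasFDerivAt_id z)).const_mul (1 / 2 : ℝ)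
  rw [hasGradientAt_iff_hasFDerivAt]
  refine (h2.congr_of_eventuallyEq (Filter.Eventually.of_forall fun w => ?_)).congr_fderiv ?_
  · simp only [hamiltonian_eq X hY w, id]
    ring
  · ext1 v
    have h3 := inner_act_comm hM v z
    have h4 : Matrix.toEuclideanLin (hamiltonianMatrix X Y) v = act (hamiltonianMatrix X Y) v := rfl
    simp [h4, h3]
    ring

theorem canonicalGroup_zero [DecidableEq ι] {X Y : Matrix ι ι ℝ} (hX : X.IsSymm) (hY : Y.IsSymm) :
    canonicalGroup hX hY 0 = 1 := by
  ext1
  simp [canonicalGroup]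

/-- Hamilton's equations `ż = J ∇H_XY(z)` for `z(t) = S_t z`. -/
theorem hasDerivAt_canonicalGroup [DecidableEq ι] {X Y : Matrix ι ι ℝ} (hX : X.IsSymm) (hY : Y.IsSymm)
    (z : Phase ι) (t : ℝ) :
    HasDerivAt (fun s => act (canonicalGroup hX hY s : Matrix (ι ⊕ ι) (ι ⊕ ι) ℝ) z)
      (act (stdJ ι) (gradient (hamiltonian X Y)
        (act (canonicalGroup hX hY t : Matrix (ι ⊕ ι) (ι ⊕ ι) ℝ) z))) t := by
  rw [(hasGradientAt_hamiltonian hX hY _).gradient]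
  open scoped Matrix.Norms.Operator in
  have h1 := hasDerivAt_exp_smul_const' (𝕂 := ℝ) (stdJ ι * hamiltonianMatrix X Y) t
  open scoped Matrix.Norms.Operator in
  have h2 : HasDerivAt (fun s => act (canonicalGroup hX hY s : Matrix (ι ⊕ ι) (ι ⊕ ι) ℝ) z)
      _ t := (LinearMap.toContinuousLinearMap (
      { toFun := fun A => act A z
        map_add' := fun A B => by simp [act, Matrix.add_mulVec]
        map_smul' := fun c A => by simp [act, Matrix.smul_mulVec] } :
        Matrix (ι ⊕ ι) (ι ⊕ ι) ℝ →ₗ[ℝ] Phase ι)).hasFDerivAt.comp_hasDerivAt t h1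
  convert! h2 using 1
  simp [act, canonicalGroup, Matrix.mulVec_mulVec, mul_assoc]
  rfl

/-- The transformed symbol `a ∘ S`. -/
def symbolComp (a : Phase ι → ℂ) (S : Matrix (ι ⊕ ι) (ι ⊕ ι) ℝ) (z : Phase ι) : ℂ :=
  a (act S z)

/-! ### The metaplectic group -/

/-- `U = Ĵ`, where `Ĵψ(x) = (1/(2πiħ))^{n/2} ∫ exp(-(i/ħ) x·x') ψ(x') dx'`
(the integral formula determines `Ĵ` on the dense subspace `L¹ ∩ L²`). -/
def IsJHat (ħ : ℝ) (U : Unitaries ι) : Prop :=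
  ∀ ψ : L2 ι, Integrable ψ volume →
    (U ψ : Config ι → ℂ) =ᵐ[volume] fun x =>
      (1 / (2 * Real.pi * Complex.I * ħ) : ℂ) ^ ((Fintype.card ι : ℂ) / 2) *
        ∫ x' : Config ι, Complex.exp (-(Complex.I / ħ) * ((inner ℝ x x' : ℝ) : ℂ)) * ψ x'

/-- `U = V̂_P`, where `V̂_Pψ(x) = exp(-(i/2ħ) Px·x) ψ(x)`. -/
def IsVHat (ħ : ℝ) (P : Matrix ι ι ℝ) (U : Unitaries ι) : Prop :=
  ∀ ψ : L2 ι, (U ψ : Config ι → ℂ) =ᵐ[volume] fun x =>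
    Complex.exp (-(Complex.I / (2 * ħ)) * ((inner ℝ (act P x) x : ℝ) : ℂ)) * ψ x

/-- `U = M̂_{L,m}`, where `M̂_{L,m}ψ(x) = iᵐ |det L|^{1/2} ψ(Lx)`. -/
def IsMHat [DecidableEq ι] (L : Matrix ι ι ℝ) (m : ℤ) (U : Unitaries ι) : Prop :=
  ∀ ψ : L2 ι, (U ψ : Config ι → ℂ) =ᵐ[volume] fun x =>
    Complex.I ^ m * ((Real.sqrt |L.det| : ℝ) : ℂ) * ψ (act L x)

/-- The generators of `Mp(n)` paired with their projections on `Sp(n)`: `(Ĵ, J)`;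
`(V̂_P, V_P)` with `V_P = (I 0; -P I)`, `P` symmetric; `(M̂_{L,m}, M_L)` with
`M_L = (L⁻¹ 0; 0 Lᵀ)`, `L` invertible and `mπ` an argument of `det L`, that is
`(-1)ᵐ det L > 0`. -/
def metaplecticGenerators (ι : Type*) [Fintype ι] [DecidableEq ι] (ħ : ℝ) :
    Set (Unitaries ι × Matrix.symplecticGroup ι ℝ) :=
  {w | IsJHat ħ w.1 ∧ (w.2 : Matrix (ι ⊕ ι) (ι ⊕ ι) ℝ) = stdJ ι} ∪
  {w | ∃ P : Matrix ι ι ℝ, P.IsSymm ∧ IsVHat ħ P w.1 ∧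
    (w.2 : Matrix (ι ⊕ ι) (ι ⊕ ι) ℝ) = Matrix.fromBlocks 1 0 (-P) 1} ∪
  {w | ∃ (L : Matrix ι ι ℝ) (m : ℤ), 0 < (-1 : ℝ) ^ m * L.det ∧ IsMHat L m w.1 ∧
    (w.2 : Matrix (ι ⊕ ι) (ι ⊕ ι) ℝ) = Matrix.fromBlocks L⁻¹ 0 0 L.transpose}

/-- The graph of the covering homomorphism `π_Mp : Mp(n) → Sp(n)`: the subgroup of
`U(L²(ℝⁿ)) × Sp(n)` generated by the generators of `Mp(n)` and their projections. -/
def metaplecticGraph (ι : Type*) [Fintype ι] [DecidableEq ι] (ħ : ℝ) :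
    Subgroup (Unitaries ι × Matrix.symplecticGroup ι ℝ) :=
  Subgroup.closure (metaplecticGenerators ι ħ)

/-- The metaplectic group `Mp(n)`, generated by all `Ĵ`, `V̂_P`, `M̂_{L,m}`. -/
def metaplecticGroup (ι : Type*) [Fintype ι] [DecidableEq ι] (ħ : ℝ) : Subgroup (Unitaries ι) :=
  (metaplecticGraph ι ħ).map (MonoidHom.fst _ _)

/-- `U` belongs to `Mp(n)` and covers `S`, that is `π_Mp(U) = S`. -/
def Covers [DecidableEq ι] (ħ : ℝ) (U : Unitaries ι) (S : Matrix.symplecticGroup ι ℝ) : Prop :=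
  (U, S) ∈ metaplecticGraph ι ħ

/-- `(Ŝ_t)` is a (strongly continuous) one-parameter subgroup of `Mp(n)` covering `(S_t)`. -/
structure IsMetaplecticLift [DecidableEq ι] (ħ : ℝ) (S : ℝ → Matrix.symplecticGroup ι ℝ)
    (Shat : ℝ → Unitaries ι) : Prop where
  mem : ∀ t, Shat t ∈ metaplecticGroup ι ħ
  covers : ∀ t, Covers ħ (Shat t) (S t)
  map_add : ∀ s t, Shat (s + t) = Shat s * Shat t
  continuous : ∀ ψ : L2 ι, Continuous fun t => Shat t ψ

end

end BlobQuantization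

/-! Everything rests on two facts: a metaplectic operator U covering S satisfies U T̂(z) = T̂(Sz) U
(`Covers.apply_displace`), and the Gaussian ψ_XY is an eigenvector, with eigenvalue c of modulus
one, of every operator in a lift of its canonical group (`IsMetaplecticLift.apply_gaussian`).
Conjugating the Toeplitz integrand by U then replaces z by Sz and produces the factor c c̄ = 1;
since det S = 1, the change of variables gives the identity (`toeplitz_covariance`).

For the eigenvector property, choose L with LᵀL = X and LLᵀ = diag(d). The product of the shear by Y
and the dilation by L conjugates S_t to rotations by the angles t dᵢ in the planes (xᵢ, pᵢ)
(`canonicalGroup_eq_conj`), and its metaplectic counterpart sends exp(-|x|²/2ħ) to a multiple of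
ψ_XY. A rotation with angles in (0, π) is a product of generators, and explicit Gaussian integrals
give the eigenvalue exp(-(i/2) ∑ θᵢ) (`exists_covers_rotation`). This treats small t > 0. The times
t for which some operator covers S_t with eigenvalue exp(-i t τ/2) form an additive group, hence are
all of ℝ.

Displaced Gaussians are total, so a covering operator is determined by its projection and its value
on ψ_XY (`Covers.unique`). Prescribing the eigenvalue therefore yields a one-parameter group. For an
arbitrary lift, two operators covering the same S send a state to vectors with the same ambiguity
function, hence to vectors equal up to a phase (`exists_smul_eq_of_ambiguity_eq`); the kernel of the
covering is never needed.

Absolute convergence follows because the symbol and the coefficient z ↦ (ψ|T̂(z)φ) are both in L²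
(`memLp_inner_displace`). Invariance of S₀ follows from a linear change of variables of determinant
one in the Wigner transform. -/

/-! ### The Fourier transform on L¹ and on L¹ ∩ L². -/

open scoped FourierTransform ContDiff SchwartzMap in
theorem ae_eq_of_integral_schwartzMap_mul_eq {V : Type*} [NormedAddCommGroup V]
    [InnerProductSpace ℝ V] [FiniteDimensional ℝ V] [MeasurableSpace V] [BorelSpace V]
    {f g : V → ℂ} (hf : LocallyIntegrable f) (hg : LocallyIntegrable g)
    (h : ∀ φ : 𝓢(V, ℂ), ∫ x, φ x * f x = ∫ x, φ x * g x) : f =ᵐ[volume] g := by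
  refine ae_eq_of_integral_contDiff_smul_eq hf hg fun u hu huc => ?_
  have h1 : HasCompactSupport (Complex.ofRealCLM ∘ u) := huc.comp_left rfl
  have h2 : ContDiff ℝ ∞ (Complex.ofRealCLM ∘ u) := by fun_prop
  simpa using h (h1.toSchwartzMap h2)

open scoped FourierTransform SchwartzMap in
theorem integral_fourier_mul_eq {V : Type*} [NormedAddCommGroup V]
    [InnerProductSpace ℝ V] [FiniteDimensional ℝ V] [MeasurableSpace V] [BorelSpace V]
    {f g : V → ℂ} (hf : Integrable f) (hg : Integrable g) :
    ∫ x, 𝓕 f x * g x = ∫ x, f x * 𝓕 g x := by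
  have := VectorFourier.integral_fourierIntegral_smul_eq_flip (μ := volume) (ν := volume)
    (L := innerₗ V) Real.continuous_fourierChar continuous_inner hf hg
  rw [flip_innerₗ] at this
  exact this

open scoped FourierTransform in
theorem continuous_fourier_of_integrable {V : Type*} [NormedAddCommGroup V]
    [InnerProductSpace ℝ V] [FiniteDimensional ℝ V] [MeasurableSpace V] [BorelSpace V]
    {f : V → ℂ} (hf : Integrable f) : Continuous (𝓕 f) :=
  VectorFourier.fourierIntegral_continuous (L := innerₗ V) Real.continuous_fourierChar
    continuous_inner hf

open scoped FourierTransform SchwartzMap in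
/-- Injectivity of the Fourier transform on `L¹`. -/
theorem ae_eq_of_fourier_eq {V : Type*} [NormedAddCommGroup V]
    [InnerProductSpace ℝ V] [FiniteDimensional ℝ V] [MeasurableSpace V] [BorelSpace V]
    {f g : V → ℂ} (hf : Integrable f) (hg : Integrable g) (h : 𝓕 f = 𝓕 g) :
    f =ᵐ[volume] g := by
  refine ae_eq_of_integral_schwartzMap_mul_eq hf.locallyIntegrable hg.locallyIntegrable
    fun φ => ?_
  -- Every Schwartz φ is the transform of its inverse transform, so the pairing with φ sees f and g
  -- only through 𝓕 f and 𝓕 g.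
  have h1 := integral_fourier_mul_eq (𝓕⁻ φ : 𝓢(V, ℂ)).integrable hf
  have h2 := integral_fourier_mul_eq (𝓕⁻ φ : 𝓢(V, ℂ)).integrable hg
  have h3 : 𝓕 (⇑(𝓕⁻ φ : 𝓢(V, ℂ)) : V → ℂ) = φ := by
    rw [← SchwartzMap.fourier_coe]; simp
  rw [h3] at h1 h2
  rw [h1, h2, h]

open scoped FourierTransform SchwartzMap in
/-- The `L²` Fourier transform is given by the integral on `L¹ ∩ L²`. -/
theorem coeFn_fourierTransformₗᵢ {V : Type*} [NormedAddCommGroup V]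
    [InnerProductSpace ℝ V] [FiniteDimensional ℝ V] [MeasurableSpace V] [BorelSpace V]
    (f : Lp (α := V) ℂ 2) (hf : Integrable f) :
    (Lp.fourierTransformₗᵢ V ℂ f : V → ℂ) =ᵐ[volume] 𝓕 (f : V → ℂ) := by
  refine ae_eq_of_integral_schwartzMap_mul_eq ((Lp.memLp _).locallyIntegrable (by norm_num))
    (continuous_fourier_of_integrable hf).locallyIntegrable fun φ => ?_
  -- The L² transform agrees with the transform of tempered distributions, which is defined by the
  -- duality of `integral_fourier_mul_eq`.
  have h1 := congrArg (fun T => T φ) (Lp.fourier_toTemperedDistribution_eq f)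
  simp only [TemperedDistribution.fourier_apply, Lp.toTemperedDistribution_apply,
    smul_eq_mul] at h1
  rw [← integral_fourier_mul_eq φ.integrable hf]
  exact h1.symm

-- Plancherel for the integral transform, in the lower-integral form that combines with Tonelli in
-- `memLp_inner_displace`.
open scoped FourierTransform in
theorem lintegral_enorm_fourier_sq {V : Type*} [NormedAddCommGroup V]
    [InnerProductSpace ℝ V] [FiniteDimensional ℝ V] [MeasurableSpace V] [BorelSpace V]
    {f : V → ℂ} (hf : Integrable f) (hf2 : MemLp f 2) :
    ∫⁻ w, ‖𝓕 f w‖ₑ ^ 2 = ∫⁻ x, ‖f x‖ₑ ^ 2 := by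
  have e := hf2.coeFn_toLp
  have h1 := coeFn_fourierTransformₗᵢ (hf2.toLp f) (hf.congr e.symm)
  have h2 : 𝓕 (hf2.toLp f : V → ℂ) = 𝓕 f := by
    ext w
    simp only [Real.fourier_eq]
    refine integral_congr_ae ?_
    filter_upwards [e] with x hx
    rw [hx]
  rw [h2] at h1
  have h3 : ‖Lp.fourierTransformₗᵢ V ℂ (hf2.toLp f)‖ₑ = ‖hf2.toLp f‖ₑ := by
    rw [← ofReal_norm, ← ofReal_norm, LinearIsometryEquiv.norm_map]
  rw [Lp.enorm_def, Lp.enorm_def, eLpNorm_congr_ae h1, eLpNorm_congr_ae e] at h3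
  have h4 (u : V → ℂ) : ∫⁻ x, ‖u x‖ₑ ^ 2 = eLpNorm u 2 volume ^ 2 := by
    rw [eLpNorm_eq_lintegral_rpow_enorm_toReal (by norm_num) (by norm_num), ← ENNReal.rpow_natCast,
      ← ENNReal.rpow_mul]
    simp
  rw [h4, h4, h3]

namespace BlobQuantization

noncomputable section

/-! ### Matrices acting on Euclidean space -/

section Act

variable {κ : Type*} [Fintype κ]

theorem act_add (A : Matrix κ κ ℝ) (v w : EuclideanSpace ℝ κ) :
    act A (v + w) = act A v + act A w := by
  simp [act, Matrix.mulVec_add]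

theorem act_sub (A : Matrix κ κ ℝ) (v w : EuclideanSpace ℝ κ) :
    act A (v - w) = act A v - act A w := by
  simp [act, Matrix.mulVec_sub]

theorem act_act (A B : Matrix κ κ ℝ) (v : EuclideanSpace ℝ κ) :
    act A (act B v) = act (A * B) v := by
  simp [act, Matrix.mulVec_mulVec]

theorem act_one [DecidableEq κ] (v : EuclideanSpace ℝ κ) : act (1 : Matrix κ κ ℝ) v = v := by
  simp [act]

theorem inner_act_transpose (A : Matrix κ κ ℝ) (v w : EuclideanSpace ℝ κ) :
    inner ℝ (act A.transpose v) w = inner ℝ v (act A w) := by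
  rw [inner_act, real_inner_comm, inner_act, Matrix.dotProduct_mulVec, Matrix.vecMul_transpose,
    dotProduct_comm]

/-- An invertible matrix acting as a measurable equivalence. -/
def actEquiv [DecidableEq κ] (A : Matrix κ κ ℝ) (hA : A.det ≠ 0) :
    EuclideanSpace ℝ κ ≃ᵐ EuclideanSpace ℝ κ where
  toFun := act A
  invFun := act A⁻¹
  left_inv v := by rw [act_act, Matrix.nonsing_inv_mul _ (Ne.isUnit hA), act_one]
  right_inv v := by rw [act_act, Matrix.mul_nonsing_inv _ (Ne.isUnit hA), act_one]
  measurable_toFun := (continuous_act A).measurable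
  measurable_invFun := (continuous_act A⁻¹).measurable

@[simp]
theorem coe_actEquiv [DecidableEq κ] (A : Matrix κ κ ℝ) (hA : A.det ≠ 0) :
    ⇑(actEquiv A hA) = act A := rfl

theorem map_act_volume [DecidableEq κ] (A : Matrix κ κ ℝ) (hA : A.det ≠ 0) :
    Measure.map (act A) volume = ENNReal.ofReal |A.det⁻¹| • volume := by
  have h1 : act A = ⇑(Matrix.toEuclideanLin A) := rfl
  have h2 : LinearMap.det (Matrix.toEuclideanLin A) = A.det := LinearMap.det_toLpLin 2 A
  rw [h1, Measure.map_linearMap_addHaar_eq_smul_addHaar _ (by rwa [h2]), h2]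

theorem measurePreserving_act [DecidableEq κ] {A : Matrix κ κ ℝ} (hA : A.det = 1) :
    MeasurePreserving (act A) volume volume :=
  ⟨(continuous_act A).measurable, by simp [map_act_volume A (by simp [hA]), hA]⟩

theorem quasiMeasurePreserving_act [DecidableEq κ] {A : Matrix κ κ ℝ} (hA : A.det ≠ 0) :
    Measure.QuasiMeasurePreserving (act A) volume volume :=
  ⟨(continuous_act A).measurable, by
    rw [map_act_volume A hA]; exact Measure.smul_absolutelyContinuous⟩

end Act

/-! ### Position and momentum coordinates on phase space. -/

section Phase

variable {ι : Type*}

@[fun_prop]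
theorem continuous_pos : Continuous (pos : Phase ι → Config ι) :=
  (PiLp.continuous_toLp 2 _).comp (by fun_prop)

@[fun_prop]
theorem continuous_mom : Continuous (mom : Phase ι → Config ι) :=
  (PiLp.continuous_toLp 2 _).comp (by fun_prop)

/-- The point of phase space with given position and momentum. -/
def phasePoint (x p : Config ι) : Phase ι := WithLp.toLp 2 (Sum.elim x.ofLp p.ofLp)

@[simp]
theorem pos_phasePoint (x p : Config ι) : pos (phasePoint x p) = x := rfl

@[simp]
theorem mom_phasePoint (x p : Config ι) : mom (phasePoint x p) = p := rfl

theorem phasePoint_pos_mom (z : Phase ι) : phasePoint (pos z) (mom z) = z := by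
  ext i
  cases i <;> rfl

@[fun_prop]
theorem continuous_phasePoint :
    Continuous fun q : Config ι × Config ι => phasePoint q.1 q.2 := by
  refine (PiLp.continuous_toLp 2 _).comp (continuous_pi fun i => ?_)
  cases i <;> simp only [Sum.elim_inl, Sum.elim_inr] <;> fun_prop

end Phase

variable {ι : Type*} [Fintype ι]

/-- Allows phase-space integrals to be iterated over position and momentum. -/
theorem measurePreserving_pos_mom :
    MeasurePreserving (fun z : Phase ι => (pos z, mom z)) volume volume := by
  have h1 := PiLp.volume_preserving_ofLp (ι ⊕ ι)
  have h2 := volume_measurePreserving_sumPiEquivProdPi (fun _ : ι ⊕ ι => ℝ)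
  have h3 := (PiLp.volume_preserving_toLp ι).prod (PiLp.volume_preserving_toLp ι)
  exact (h3.comp h2).comp h1

theorem act_fromBlocks (A B C D : Matrix ι ι ℝ) (z : Phase ι) :
    act (Matrix.fromBlocks A B C D) z =
      phasePoint (act A (pos z) + act B (mom z)) (act C (pos z) + act D (mom z)) := by
  have hz : z.ofLp = Sum.elim (pos z).ofLp (mom z).ofLp := by
    ext i
    cases i <;> rfl
  rw [act, hz, Matrix.fromBlocks_mulVec]
  rfl

/-! ### Unitaries given by pointwise formulas -/

/-- `f ↦ w · (f ∘ e)` is unitary if `|w|` is constant and equals the square root of the factor by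
which `e` expands the volume. -/
theorem exists_unitary_weighted_comp {w : Config ι → ℂ} (hw : Measurable w)
    (e : Config ι ≃ᵐ Config ι) {c : ℝ} (hc : 0 < c) (hn : ∀ x, ‖w x‖ = c)
    (he : Measure.map e volume = ENNReal.ofReal (c ^ 2)⁻¹ • (volume : Measure (Config ι))) :
    ∃ U : Unitaries ι, ∀ f : L2 ι, U f =ᵐ[volume] fun x => w x * f (e x) := by
  have hq : Measure.QuasiMeasurePreserving e volume volume :=
    ⟨e.measurable, by rw [he]; exact Measure.smul_absolutelyContinuous⟩
  have hsymm : Measure.map e.symm volume = ENNReal.ofReal (c ^ 2) • volume := by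
    have h1 : (volume : Measure (Config ι)) = ENNReal.ofReal (c ^ 2) • Measure.map e volume := by
      rw [he, smul_smul, ← ENNReal.ofReal_mul (by positivity), mul_inv_cancel₀ (by positivity)]
      simp
    conv_lhs => rw [h1]
    rw [Measure.map_smul, e.map_symm_map]
  have hqs : Measure.QuasiMeasurePreserving e.symm volume volume :=
    ⟨e.symm.measurable, by rw [hsymm]; exact Measure.smul_absolutelyContinuous⟩
  -- The factor c from the weight cancels the factor c⁻¹ produced by the change of variables.
  have hnorm (f : L2 ι) : eLpNorm (fun x => w x * f (e x)) 2 volume = eLpNorm f 2 volume := by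
    have h1 : eLpNorm (fun x => w x * f (e x)) 2 volume
        = eLpNorm ((c : ℂ) • fun x => f (e x)) 2 volume := by
      refine eLpNorm_congr_norm_ae (Filter.Eventually.of_forall fun x => ?_)
      simp [hn, abs_of_pos hc]
    have h2 : eLpNorm (fun x => f (e x)) 2 volume = eLpNorm f 2 (Measure.map e volume) := by
      rw [eLpNorm_map_measure _ e.measurable.aemeasurable]
      · rfl
      · rw [he]; exact (Lp.aestronglyMeasurable f).smul_measure _
    rw [h1, eLpNorm_const_smul, h2, he, eLpNorm_smul_measure_of_ne_top (by norm_num), smul_eq_mul,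
      ← mul_assoc, ENNReal.ofReal_rpow_of_pos (by positivity), ← ofReal_norm,
      ← ENNReal.ofReal_mul (by positivity)]
    have h3 : ((c ^ 2)⁻¹ : ℝ) ^ ((1 / 2 : ENNReal)).toReal = c⁻¹ := by
      rw [← inv_pow, ← Real.rpow_natCast, ← Real.rpow_mul (by positivity)]
      simp
    rw [h3]
    simp [abs_of_pos hc, hc.ne']
  have hmem (f : L2 ι) : MemLp (fun x => w x * f (e x)) 2 volume :=
    ⟨hw.aestronglyMeasurable.mul ((Lp.aestronglyMeasurable f).comp_quasiMeasurePreserving hq),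
      by rw [hnorm]; exact (Lp.memLp f).2⟩
  let T : L2 ι →ₗᵢ[ℂ] L2 ι :=
    { toFun := fun f => (hmem f).toLp _
      map_add' := fun f g => by
        refine Lp.ext ?_
        filter_upwards [(hmem (f + g)).coeFn_toLp, (hmem f).coeFn_toLp, (hmem g).coeFn_toLp,
          Lp.coeFn_add ((hmem f).toLp _) ((hmem g).toLp _), hq.ae (Lp.coeFn_add f g)]
          with x h1 h2 h3 h4 h5
        rw [h1, h4, Pi.add_apply, h2, h3, h5, Pi.add_apply, mul_add]
      map_smul' := fun a f => by
        refine Lp.ext ?_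
        filter_upwards [(hmem (a • f)).coeFn_toLp, (hmem f).coeFn_toLp,
          Lp.coeFn_smul a ((hmem f).toLp _), hq.ae (Lp.coeFn_smul a f)]
          with x h1 h2 h4 h5
        rw [h1, RingHom.id_apply, h4, Pi.smul_apply, h2, h5, Pi.smul_apply, smul_eq_mul, smul_eq_mul]
        ring
      norm_map' := fun f => by
        change ‖(hmem f).toLp _‖ = ‖f‖
        rw [Lp.norm_toLp, hnorm, Lp.norm_def] }
  -- The preimage of f is explicit: divide by the weight and compose with the inverse of e.
  have hsurj : Function.Surjective T := fun f => by
    have hm : MemLp (fun x => (w (e.symm x))⁻¹ * f (e.symm x)) 2 volume := by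
      have h1 : MemLp (fun x => f (e.symm x)) 2 volume := by
        refine MemLp.comp_of_map (g := f) ?_ e.symm.measurable.aemeasurable
        rw [hsymm]
        exact (Lp.memLp f).smul_measure (by simp)
      refine (h1.const_mul ((c : ℂ)⁻¹)).congr_norm
        ((hw.comp e.symm.measurable).inv.aestronglyMeasurable.mul h1.1)
        (Filter.Eventually.of_forall fun x => ?_)
      simp [hn, abs_of_pos hc]
    refine ⟨hm.toLp _, Lp.ext ?_⟩
    filter_upwards [(hmem (hm.toLp _)).coeFn_toLp, hq.ae hm.coeFn_toLp] with x h1 h2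
    have hx : w x ≠ 0 := by rw [← norm_pos_iff, hn]; exact hc
    change ((hmem (hm.toLp _)).toLp _ : Config ι → ℂ) x = _
    rw [h1, h2, e.symm_apply_apply, mul_inv_cancel_left₀ hx]
  exact ⟨LinearIsometryEquiv.ofSurjective T hsurj, fun f => (hmem f).coeFn_toLp⟩

theorem exists_isVHat (ħ : ℝ) (P : Matrix ι ι ℝ) : ∃ U : Unitaries ι, IsVHat ħ P U := by
  have hP := continuous_act P
  refine exists_unitary_weighted_comp (c := 1)
    (w := fun x => Complex.exp (-(Complex.I / (2 * ħ)) * ((inner ℝ (act P x) x : ℝ) : ℂ)))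
    (Continuous.measurable (by fun_prop)) (MeasurableEquiv.refl _) one_pos (fun x => ?_)
    (by rw [show ⇑(MeasurableEquiv.refl (Config ι)) = id from rfl, Measure.map_id]; simp)
  have : -(Complex.I / (2 * ħ)) * ((inner ℝ (act P x) x : ℝ) : ℂ)
      = ((-(inner ℝ (act P x) x / (2 * ħ)) : ℝ) : ℂ) * Complex.I := by push_cast; ring
  rw [this, Complex.norm_exp_ofReal_mul_I]

theorem exists_isMHat [DecidableEq ι] {L : Matrix ι ι ℝ} (hL : L.det ≠ 0) (m : ℤ) :
    ∃ U : Unitaries ι, IsMHat L m U := by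
  refine exists_unitary_weighted_comp (c := Real.sqrt |L.det|)
    (w := fun _ => Complex.I ^ m * ((Real.sqrt |L.det| : ℝ) : ℂ))
    measurable_const (actEquiv L hL) (by positivity) (fun x => ?_) ?_
  · simp
  · rw [coe_actEquiv, map_act_volume L hL, Real.sq_sqrt (abs_nonneg _), abs_inv]

/-! ### Displacements -/

theorem coeFn_displace (ħ : ℝ) (z : Phase ι) (φ : L2 ι) :
    displace ħ z φ =ᵐ[volume] displaceFun ħ z φ :=
  (memLp_displaceFun ħ z (Lp.memLp φ)).coeFn_toLp

theorem norm_displacePhase (ħ : ℝ) (z : Phase ι) (x : Config ι) :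
    ‖Complex.exp (Complex.I / ħ *
      ((inner ℝ (mom z) x - inner ℝ (mom z) (pos z) / 2 : ℝ) : ℂ))‖ = 1 := by
  have h2 : Complex.I / (ħ : ℂ) * ((inner ℝ (mom z) x - inner ℝ (mom z) (pos z) / 2 : ℝ) : ℂ)
      = (((inner ℝ (mom z) x - inner ℝ (mom z) (pos z) / 2) / ħ : ℝ) : ℂ) * Complex.I := by
    push_cast; ring
  rw [h2, Complex.norm_exp_ofReal_mul_I]

/-- Source of the linearity, isometry and continuity of `displace` in the state. -/
theorem exists_unitary_displace (ħ : ℝ) (z : Phase ι) :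
    ∃ U : Unitaries ι, ∀ φ, U φ = displace ħ z φ := by
  obtain ⟨U, hU⟩ := exists_unitary_weighted_comp (c := 1)
    (w := fun x => Complex.exp (Complex.I / ħ *
      ((inner ℝ (mom z) x - inner ℝ (mom z) (pos z) / 2 : ℝ) : ℂ)))
    (Continuous.measurable (by fun_prop)) (MeasurableEquiv.subRight (pos z)) one_pos
    (norm_displacePhase ħ z)
    (by rw [show ⇑(MeasurableEquiv.subRight (pos z)) = fun x => x - pos z from rfl,
      (measurePreserving_sub_right volume (pos z)).map_eq]; simp)
  exact ⟨U, fun φ => Lp.ext ((hU φ).trans (coeFn_displace ħ z φ).symm)⟩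

/-- The displacement operator as a unitary. -/
def displaceU (ħ : ℝ) (z : Phase ι) : Unitaries ι := (exists_unitary_displace ħ z).choose

@[simp]
theorem displaceU_apply (ħ : ℝ) (z : Phase ι) (φ : L2 ι) :
    displaceU ħ z φ = displace ħ z φ := (exists_unitary_displace ħ z).choose_spec φ

theorem norm_displace (ħ : ℝ) (z : Phase ι) (φ : L2 ι) : ‖displace ħ z φ‖ = ‖φ‖ := by
  rw [← displaceU_apply, LinearIsometryEquiv.norm_map]

theorem displace_smul (ħ : ℝ) (z : Phase ι) (c : ℂ) (φ : L2 ι) :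
    displace ħ z (c • φ) = c • displace ħ z φ := by
  simp_rw [← displaceU_apply, map_smul]

/-! ### Strong continuity of displacements. -/

/-- Dominated convergence for the squared norm, with dominating function (C |g|)². -/
theorem tendsto_eLpNorm_mul_zero {Z E : Type*} [MeasurableSpace E] {μ : Measure E} {l : Filter Z}
    [l.IsCountablyGenerated] {w : Z → E → ℂ} {g : E → ℂ} {C : ℝ}
    (hw : ∀ z, AEStronglyMeasurable (w z) μ) (hC : ∀ z x, ‖w z x‖ ≤ C)
    (hlim : ∀ x, Filter.Tendsto (fun z => w z x) l (nhds 0)) (hg : MemLp g 2 μ) :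
    Filter.Tendsto (fun z => eLpNorm (fun x => w z x * g x) 2 μ) l (nhds 0) := by
  have h0 : Filter.Tendsto (fun z => ∫⁻ x, ‖w z x * g x‖ₑ ^ (2 : ℝ) ∂μ) l
      (nhds (∫⁻ _, 0 ∂μ)) := by
    refine tendsto_lintegral_filter_of_dominated_convergence'
      (fun x => (ENNReal.ofReal C * ‖g x‖ₑ) ^ (2 : ℝ)) ?_ ?_ ?_ ?_
    · exact Filter.Eventually.of_forall fun z => ((hw z).mul hg.1).enorm.pow_const _
    · refine Filter.Eventually.of_forall fun z => Filter.Eventually.of_forall fun x => ?_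
      rw [enorm_mul]
      gcongr
      rw [← ofReal_norm]
      exact ENNReal.ofReal_le_ofReal (hC z x)
    · have h := hg.2
      rw [eLpNorm_eq_lintegral_rpow_enorm_toReal (by norm_num) (by norm_num)] at h
      simp only [ENNReal.toReal_ofNat] at h
      have h' := (ENNReal.rpow_lt_top_iff_of_pos (by norm_num)).1 h
      simp_rw [ENNReal.mul_rpow_of_nonneg _ _ (zero_le_two (α := ℝ))]
      rw [lintegral_const_mul' _ _ (by simp)]
      exact ENNReal.mul_ne_top (by simp) h'.ne
    · refine Filter.Eventually.of_forall fun x => ?_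
      have h1 : Filter.Tendsto (fun z => w z x * g x) l (nhds 0) := by
        simpa using (hlim x).mul_const (g x)
      have h2 := ((ENNReal.continuous_rpow_const (y := 2)).comp continuous_enorm).tendsto
        (0 : ℂ) |>.comp h1
      simpa only [Function.comp_def, enorm_zero, ENNReal.zero_rpow_of_pos two_pos] using h2
  have h1 := ((ENNReal.continuous_rpow_const (y := 1 / 2)).tendsto _).comp h0
  simp only [lintegral_zero] at h1
  rw [ENNReal.zero_rpow_of_pos (by norm_num)] at h1
  refine h1.congr fun z => ?_
  rw [eLpNorm_eq_lintegral_rpow_enorm_toReal (by norm_num) (by norm_num)]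
  simp

/-- Translation is the continuous action of `DomAddAct` on L²; the action precomposes with addition,
hence the sign in -x. -/
theorem exists_continuous_translate (φ : L2 ι) : ∃ τ : Config ι → L2 ι, Continuous τ ∧
    ∀ x, τ x =ᵐ[volume] fun y => φ (y - x) := by
  have : Fact ((2 : ENNReal) ≠ ⊤) := ⟨by norm_num⟩
  refine ⟨fun x => DomAddAct.mk (-x) +ᵥ φ, ?_, fun x => ?_⟩
  · have h : Continuous fun x : Config ι => DomAddAct.mk (-x) :=
      DomAddAct.continuous_mk.comp continuous_neg
    exact h.vadd continuous_const
  · refine (DomAddAct.vadd_Lp_ae_eq (DomAddAct.mk (-x)) φ).trans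
      (Filter.Eventually.of_forall fun y => ?_)
    simp [sub_eq_neg_add]

/-- The difference of two displaced states is a phase times a difference of translates, plus a
difference of phases times a fixed translate. The first is small by continuity of translation, the
second by dominated convergence. -/
theorem continuous_displace (ħ : ℝ) (φ : L2 ι) : Continuous fun z => displace ħ z φ := by
  obtain ⟨τ, hτ, hτae⟩ := exists_continuous_translate φ
  obtain ⟨w, hwn, hwc, hd⟩ : ∃ w : Phase ι → Config ι → ℂ, (∀ z x, ‖w z x‖ = 1) ∧
      Continuous (Function.uncurry w) ∧
      ∀ z, displace ħ z φ =ᵐ[volume] fun x => w z x * τ (pos z) x := by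
    refine ⟨fun z x => Complex.exp (Complex.I / ħ *
      ((inner ℝ (mom z) x - inner ℝ (mom z) (pos z) / 2 : ℝ) : ℂ)), norm_displacePhase ħ, ?_,
      fun z => ?_⟩
    · simp only [Function.uncurry_def]
      fun_prop
    · filter_upwards [coeFn_displace ħ z φ, hτae (pos z)] with x h1 h2
      rw [h1, h2, displaceFun]
  rw [continuous_iff_continuousAt]
  intro z₀
  have hlim1 : Filter.Tendsto (fun z => eLpNorm (⇑(τ (pos z)) - ⇑(τ (pos z₀))) 2 volume)
      (nhds z₀) (nhds 0) :=
    (Lp.tendsto_Lp_iff_tendsto_eLpNorm' (fun z => τ (pos z)) (τ (pos z₀))).1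
      ((hτ.comp continuous_pos).tendsto z₀)
  have hm (z : Phase ι) : AEStronglyMeasurable (w z) volume :=
    Continuous.aestronglyMeasurable (hwc.comp (by fun_prop : Continuous fun x => (z, x)))
  have hlim2 : Filter.Tendsto
      (fun z => eLpNorm (fun x => (w z x - w z₀ x) * τ (pos z₀) x) 2 volume)
      (nhds z₀) (nhds 0) := by
    refine tendsto_eLpNorm_mul_zero (C := 2) (fun z => (hm z).sub (hm z₀)) (fun z x => ?_)
      (fun x => ?_) (Lp.memLp _)
    · refine (norm_sub_le _ _).trans ?_
      rw [hwn, hwn]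
      norm_num
    · have h1 : Continuous fun z => w z x - w z₀ x :=
        (hwc.comp (by fun_prop : Continuous fun z : Phase ι => (z, x))).sub continuous_const
      simpa using h1.tendsto z₀
  refine (Lp.tendsto_Lp_iff_tendsto_eLpNorm' (fun z => displace ħ z φ) (displace ħ z₀ φ)).2 ?_
  have hle (z : Phase ι) : eLpNorm (⇑(displace ħ z φ) - ⇑(displace ħ z₀ φ)) 2 volume ≤
      eLpNorm (⇑(τ (pos z)) - ⇑(τ (pos z₀))) 2 volume +
        eLpNorm (fun x => (w z x - w z₀ x) * τ (pos z₀) x) 2 volume := by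
    have h1 : ⇑(displace ħ z φ) - ⇑(displace ħ z₀ φ) =ᵐ[volume]
        (fun x => w z x * (⇑(τ (pos z)) - ⇑(τ (pos z₀))) x) +
          fun x => (w z x - w z₀ x) * τ (pos z₀) x := by
      filter_upwards [hd z, hd z₀] with x h1 h2
      simp only [Pi.sub_apply, Pi.add_apply, h1, h2]
      ring
    have h2 : eLpNorm (fun x => w z x * (⇑(τ (pos z)) - ⇑(τ (pos z₀))) x) 2 volume
        = eLpNorm (⇑(τ (pos z)) - ⇑(τ (pos z₀))) 2 volume :=
      eLpNorm_congr_norm_ae (Filter.Eventually.of_forall fun x => by rw [norm_mul, hwn, one_mul])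
    have hs := (Lp.aestronglyMeasurable (τ (pos z))).sub (Lp.aestronglyMeasurable (τ (pos z₀)))
    rw [eLpNorm_congr_ae h1, ← h2]
    exact eLpNorm_add_le ((hm z).mul hs)
      (((hm z).sub (hm z₀)).mul (Lp.aestronglyMeasurable _)) one_le_two
  have hlim := hlim1.add hlim2
  rw [add_zero] at hlim
  exact tendsto_of_tendsto_of_tendsto_of_le_of_le tendsto_const_nhds hlim (fun _ => zero_le) hle

/-! ### Overlaps with displaced states -/

/-- `f` times the complex conjugate of the translate of `φ` by `x₀`. -/
def overlapFun (φ f : Config ι → ℂ) (x₀ x : Config ι) : ℂ :=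
  f x * (starRingEnd ℂ) (φ (x - x₀))

theorem integrable_overlapFun (φ f : L2 ι) (x₀ : Config ι) :
    Integrable (overlapFun φ f x₀) volume := by
  have h1 : MemLp (fun x => φ (x - x₀)) 2 volume :=
    (Lp.memLp φ).comp_measurePreserving (measurePreserving_sub_right volume x₀)
  exact (Lp.memLp f).integrable_mul h1.star

-- At fixed position, the matrix coefficient is up to a phase the Fourier transform, in the rescaled
-- momentum, of an L¹ function. Totality, uniqueness up to phase and square integrability all come
-- from this.
open scoped FourierTransform in
theorem inner_displace (ħ : ℝ) (z : Phase ι) (φ f : L2 ι) :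
    inner ℂ (displace ħ z φ) f =
      Complex.exp (Complex.I / ħ * ((inner ℝ (mom z) (pos z) / 2 : ℝ) : ℂ)) *
        𝓕 (overlapFun φ f (pos z)) ((2 * Real.pi * ħ)⁻¹ • mom z) := by
  rw [L2.inner_def, Real.fourier_eq, ← integral_const_mul]
  refine integral_congr_ae ?_
  filter_upwards [coeFn_displace ħ z φ] with x hx
  rw [hx, RCLike.inner_apply, displaceFun, overlapFun, Circle.smul_def, Real.fourierChar_apply,
    map_mul, ← Complex.exp_conj, smul_eq_mul]
  have h1 : (starRingEnd ℂ) (Complex.I / ħ *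
      ((inner ℝ (mom z) x - inner ℝ (mom z) (pos z) / 2 : ℝ) : ℂ)) =
      Complex.I / ħ * ((inner ℝ (mom z) (pos z) / 2 : ℝ) : ℂ) +
        ((2 * Real.pi * -(inner ℝ x ((2 * Real.pi * ħ)⁻¹ • mom z)) : ℝ) : ℂ) * Complex.I := by
    rw [inner_smul_right, real_inner_comm]
    simp only [map_mul, map_div₀, Complex.conj_I, Complex.conj_ofReal]
    push_cast
    have : (Real.pi : ℂ) ≠ 0 := by exact_mod_cast Real.pi_ne_zero
    field_simp
    ring
  rw [h1, Complex.exp_add]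
  ring

open scoped FourierTransform in
theorem fourier_overlapFun {ħ : ℝ} (hħ : ħ ≠ 0) (φ f : L2 ι) (x w : Config ι) :
    ‖𝓕 (overlapFun φ f x) w‖ =
      ‖inner ℂ (displace ħ (phasePoint x ((2 * Real.pi * ħ) • w)) φ) f‖ := by
  have h1 (r : ℝ) : ‖Complex.exp (Complex.I / ħ * (r : ℂ))‖ = 1 := by
    have : Complex.I / ħ * (r : ℂ) = ((r / ħ : ℝ) : ℂ) * Complex.I := by push_cast; ring
    rw [this, Complex.norm_exp_ofReal_mul_I]
  rw [inner_displace, norm_mul, h1, one_mul, pos_phasePoint, mom_phasePoint,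
    inv_smul_smul₀ (by positivity)]

/-! ### Totality of displaced states and recovery of a state from its ambiguity function. -/

/-- Pure modulations suffice: at position 0 the coefficients are the Fourier transform of f φ̄, and
φ can be divided out. -/
theorem eq_zero_of_inner_displace_eq_zero {ħ : ℝ} (hħ : ħ ≠ 0) {φ : L2 ι}
    (hφ : ∀ᵐ x, φ x ≠ 0) {f : L2 ι} (h : ∀ z, inner ℂ (displace ħ z φ) f = 0) : f = 0 := by
  have h1 : overlapFun φ f 0 =ᵐ[volume] 0 :=
    ae_eq_of_fourier_eq (integrable_overlapFun φ f 0) (integrable_zero _ _ _) <| funext fun w => by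
      rw [← sub_eq_zero, ← norm_eq_zero, show (0 : Config ι → ℂ) = fun _ => 0 from rfl,
        Real.fourier_eq (fun _ => 0)]
      simp [fourier_overlapFun hħ, h]
  refine Lp.ext ?_
  filter_upwards [h1, hφ, Lp.coeFn_zero ℂ 2 (volume : Measure (Config ι))] with x hx hx2 hx3
  rw [hx3]
  simpa [overlapFun, hx2] using hx

/-- The displaced copies of an almost everywhere nonzero state are total. -/
theorem topologicalClosure_span_displace {ħ : ℝ} (hħ : ħ ≠ 0) {φ : L2 ι}
    (hφ : ∀ᵐ x, φ x ≠ 0) :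
    (Submodule.span ℂ (Set.range fun z => displace ħ z φ)).topologicalClosure = ⊤ := by
  rw [Submodule.topologicalClosure_eq_top_iff, Submodule.eq_bot_iff]
  intro f hf
  refine eq_zero_of_inner_displace_eq_zero hħ hφ fun z => ?_
  exact (Submodule.mem_orthogonal _ f).1 hf _ (Submodule.subset_span ⟨z, rfl⟩)

/-- Strong continuity of a family of unitaries may be checked on a total set. -/
theorem continuous_unitary_of_total {T : Type*} [TopologicalSpace T] {U : T → Unitaries ι}
    {s : Set (L2 ι)} (hs : (Submodule.span ℂ s).topologicalClosure = ⊤)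
    (h : ∀ f ∈ s, Continuous fun t => U t f) (f : L2 ι) : Continuous fun t => U t f := by
  have hspan : ∀ g ∈ Submodule.span ℂ s, Continuous fun t => U t g := fun g hg => by
    induction hg using Submodule.span_induction with
    | mem x hx => exact h x hx
    | zero => simp only [map_zero]; exact continuous_const
    | add x y _ _ hx hy => simp only [map_add]; exact hx.add hy
    | smul c x _ hx => simp only [map_smul]; exact hx.const_smul c
  have hd : f ∈ closure (Submodule.span ℂ s : Set (L2 ι)) := by
    rw [← Submodule.topologicalClosure_coe, hs]
    trivial
  -- Isometries preserve distances, so an approximation of f by g in the span is uniform in t.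
  refine continuous_of_uniform_approx_of_continuous fun u hu => ?_
  obtain ⟨ε, hε, hεu⟩ := Metric.mem_uniformity_dist.1 hu
  obtain ⟨g, hg, hfg⟩ := Metric.mem_closure_iff.1 hd ε hε
  exact ⟨fun t => U t g, hspan g hg, fun t => hεu (by rwa [LinearIsometryEquiv.dist_map])⟩

/-- Unitaries that agree on the displaced copies of an almost everywhere nonzero state are equal. -/
theorem unitary_ext_of_displace {ħ : ℝ} (hħ : ħ ≠ 0) {φ : L2 ι} (hφ : ∀ᵐ x, φ x ≠ 0)
    {U V : Unitaries ι} (h : ∀ z, U (displace ħ z φ) = V (displace ħ z φ)) : U = V := by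
  have hd : Dense (Submodule.span ℂ (Set.range fun z => displace ħ z φ) : Set (L2 ι)) :=
    Submodule.dense_iff_topologicalClosure_eq_top.2 (topologicalClosure_span_displace hħ hφ)
  have h1 : (U.toContinuousLinearEquiv : L2 ι →L[ℂ] L2 ι) = V.toContinuousLinearEquiv := by
    refine ContinuousLinearMap.ext_on hd ?_
    rintro _ ⟨z, rfl⟩
    exact h z
  ext1 f
  exact congrArg (fun T : L2 ι →L[ℂ] L2 ι => T f) h1

/-- A state is determined up to a phase by its ambiguity function. -/
theorem exists_smul_eq_of_ambiguity_eq {ħ : ℝ} (hħ : ħ ≠ 0) {f g : L2 ι} (hn : ‖f‖ = ‖g‖)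
    (h : ∀ z, inner ℂ (displace ħ z f) f = inner ℂ (displace ħ z g) g) :
    ∃ c : ℂ, ‖c‖ = 1 ∧ g = c • f := by
  by_cases hf0 : f = 0
  · refine ⟨1, by simp, ?_⟩
    rw [hf0, norm_zero] at hn
    rw [hf0, smul_zero, norm_eq_zero.1 hn.symm]
  have h1 (x₀ : Config ι) : ∀ᵐ x, overlapFun f f x₀ x = overlapFun g g x₀ x := by
    refine ae_eq_of_fourier_eq (integrable_overlapFun f f x₀) (integrable_overlapFun g g x₀) <|
      funext fun w => ?_
    have e1 := inner_displace ħ (phasePoint x₀ ((2 * Real.pi * ħ) • w)) f f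
    rw [h, inner_displace] at e1
    have e2 := mul_left_cancel₀ (Complex.exp_ne_zero _) e1
    rw [pos_phasePoint, mom_phasePoint, inv_smul_smul₀ (by positivity)] at e2
    exact e2.symm
  have hfm : Measurable f := (Lp.stronglyMeasurable f).measurable
  have hgm : Measurable g := (Lp.stronglyMeasurable g).measurable
  have hmeas : MeasurableSet {q : Config ι × Config ι |
      overlapFun f f q.1 q.2 = overlapFun g g q.1 q.2} := by
    have hs : Measurable (starRingEnd ℂ) := Complex.continuous_conj.measurable
    refine measurableSet_eq_fun ?_ ?_ <;> unfold overlapFun <;> fun_prop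
  -- Fubini exchanges the quantifiers, so that x can be fixed and y = x - x₀ substituted: f(x) conj
  -- f(y) = g(x) conj g(y) for almost all x and y.
  have h2 : ∀ᵐ x : Config ι, ∀ᵐ x₀ : Config ι, overlapFun f f x₀ x = overlapFun g g x₀ x :=
    (Measure.ae_ae_comm hmeas).1 (Filter.Eventually.of_forall h1)
  have h3 : ∀ᵐ x : Config ι, ∀ᵐ y : Config ι,
      f x * (starRingEnd ℂ) (f y) = g x * (starRingEnd ℂ) (g y) := by
    filter_upwards [h2] with x hx
    have h4 := (Measure.measurePreserving_sub_left volume x).quasiMeasurePreserving.ae hx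
    filter_upwards [h4] with y hy
    simpa [overlapFun] using hy
  -- Multiply by g(y) and integrate over y.
  have h4 : ∀ᵐ x : Config ι, f x * inner ℂ f g = g x * inner ℂ g g := by
    filter_upwards [h3] with x hx
    rw [L2.inner_def, L2.inner_def, ← integral_const_mul, ← integral_const_mul]
    refine integral_congr_ae ?_
    filter_upwards [hx] with y hy
    rw [RCLike.inner_apply, RCLike.inner_apply]
    linear_combination g y * hy
  have hg0 : ‖g‖ ≠ 0 := by rw [← hn]; exact norm_ne_zero_iff.2 hf0
  have hgg : (inner ℂ g g : ℂ) ≠ 0 := by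
    rw [inner_self_eq_norm_sq_to_K]
    exact pow_ne_zero 2 (by simpa using hg0)
  have hgc : g = (inner ℂ f g / inner ℂ g g : ℂ) • f := by
    refine Lp.ext ?_
    filter_upwards [h4, Lp.coeFn_smul (inner ℂ f g / inner ℂ g g : ℂ) f] with x hx hx2
    rw [hx2, Pi.smul_apply, smul_eq_mul]
    field_simp
    linear_combination -hx
  refine ⟨_, ?_, hgc⟩
  have h5 := congrArg norm hgc
  rw [norm_smul, hn] at h5
  exact mul_right_cancel₀ hg0 (by rw [one_mul]; exact h5.symm)

/-! ### Square integrable coefficients and convergence of Toeplitz integrals. -/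

theorem lintegral_enorm_sq_lt_top (f : L2 ι) : ∫⁻ x, ‖f x‖ₑ ^ 2 < ⊤ := by
  have h := (Lp.memLp f).2
  rw [eLpNorm_eq_lintegral_rpow_enorm_toReal (by norm_num) (by norm_num)] at h
  simpa using (ENNReal.rpow_lt_top_iff_of_pos (by norm_num)).1 h

open scoped FourierTransform in
/-- Square integrability of the Heisenberg representation. -/
theorem memLp_inner_displace {ħ : ℝ} (hħ : ħ ≠ 0) (φ f : L2 ι) :
    MemLp (fun z => inner ℂ (displace ħ z φ) f) 2 volume := by
  have hc : Continuous fun z => inner ℂ (displace ħ z φ) f :=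
    (continuous_displace ħ φ).inner continuous_const
  refine ⟨hc.aestronglyMeasurable, ?_⟩
  rw [eLpNorm_eq_lintegral_rpow_enorm_toReal (by norm_num) (by norm_num)]
  refine (ENNReal.rpow_lt_top_iff_of_pos (by norm_num)).2 ?_
  simp only [ENNReal.toReal_ofNat, ENNReal.rpow_ofNat]
  have hfm : Measurable f := (Lp.stronglyMeasurable f).measurable
  have hφm : Measurable φ := (Lp.stronglyMeasurable φ).measurable
  have hov : Measurable (Function.uncurry fun x y => ‖overlapFun φ f x y‖ₑ ^ 2) := by
    have hs : Measurable (starRingEnd ℂ) := Complex.continuous_conj.measurable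
    unfold overlapFun Function.uncurry
    fun_prop
  -- By Tonelli and translation invariance the double integral is ‖f‖² ‖φ‖².
  have hfin : ∫⁻ x, ∫⁻ y, ‖overlapFun φ f x y‖ₑ ^ 2 < ⊤ := by
    rw [lintegral_lintegral_swap hov.aemeasurable]
    have h1 (y : Config ι) : ∫⁻ x, ‖overlapFun φ f x y‖ₑ ^ 2 =
        ‖f y‖ₑ ^ 2 * ∫⁻ x, ‖φ x‖ₑ ^ 2 := by
      have h2 := (Measure.measurePreserving_sub_left volume y).lintegral_comp
        (f := fun x => ‖φ x‖ₑ ^ 2) (by fun_prop)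
      rw [← h2, ← lintegral_const_mul _ (by fun_prop)]
      refine lintegral_congr fun x => ?_
      rw [overlapFun, enorm_mul, mul_pow]
      congr 2
      rw [← ofReal_norm, RCLike.norm_conj, ofReal_norm]
    simp_rw [h1]
    rw [lintegral_mul_const _ (by fun_prop)]
    exact ENNReal.mul_lt_top (lintegral_enorm_sq_lt_top f) (lintegral_enorm_sq_lt_top φ)
  have hae : ∀ᵐ x, ∫⁻ y, ‖overlapFun φ f x y‖ₑ ^ 2 < ⊤ :=
    ae_lt_top hov.lintegral_prod_right' hfin.ne
  have hG : Continuous fun q : Config ι × Config ι =>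
      ‖(inner ℂ (displace ħ (phasePoint q.1 q.2) φ) f : ℂ)‖ₑ ^ 2 :=
    (ENNReal.continuous_pow 2).comp (continuous_enorm.comp (hc.comp continuous_phasePoint))
  have h1 := (measurePreserving_pos_mom (ι := ι)).lintegral_comp hG.measurable
  simp only [phasePoint_pos_mom] at h1
  rw [h1, Measure.volume_eq_prod, lintegral_prod _ hG.measurable.aemeasurable]
  set s : ℝ := 2 * Real.pi * ħ with hs
  have hs0 : s ≠ 0 := by positivity
  -- Plancherel in the momentum variable, rescaled by s = 2πħ. It applies at almost every x, where
  -- the overlap is square integrable.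
  have h2 : ∀ᵐ x : Config ι, ∫⁻ p : Config ι,
      ‖(inner ℂ (displace ħ (phasePoint x p) φ) f : ℂ)‖ₑ ^ 2 =
      ENNReal.ofReal |s ^ Module.finrank ℝ (Config ι)| * ∫⁻ y, ‖overlapFun φ f x y‖ₑ ^ 2 := by
    filter_upwards [hae] with x hx
    have hI := integrable_overlapFun φ f x
    have hm : MemLp (overlapFun φ f x) 2 volume := by
      refine ⟨hI.1, ?_⟩
      rw [eLpNorm_eq_lintegral_rpow_enorm_toReal (by norm_num) (by norm_num)]
      exact (ENNReal.rpow_lt_top_iff_of_pos (by norm_num)).2 (by simpa using hx)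
    rw [← lintegral_enorm_fourier_sq hI hm]
    have h3 := Measure.map_addHaar_smul (volume : Measure (Config ι)) (inv_ne_zero hs0)
    have hFm : Measurable fun w => ‖𝓕 (overlapFun φ f x) w‖ₑ ^ 2 :=
      ((continuous_fourier_of_integrable hI).measurable.enorm).pow_const 2
    have h4 := lintegral_map (μ := (volume : Measure (Config ι))) hFm
      (measurable_const_smul (s⁻¹ : ℝ))
    rw [h3, lintegral_smul_measure, inv_pow, inv_inv] at h4
    rw [← smul_eq_mul, h4]
    refine lintegral_congr fun p => ?_
    rw [← ofReal_norm, ← ofReal_norm, fourier_overlapFun hħ, smul_inv_smul₀ hs0]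
  rw [lintegral_congr_ae h2, lintegral_const_mul' _ _ (by simp)]
  exact ENNReal.mul_lt_top (by simp) hfin

/-- The scalar factor is a product of two L² functions, hence integrable, and the vector factor has
constant norm ‖φ‖. -/
theorem integrable_toeplitzIntegrand {ħ : ℝ} (hħ : ħ ≠ 0) (φ : L2 ι) {a : Phase ι → ℂ}
    (ha : MemLp a 2 volume) (ψ : L2 ι) : Integrable (toeplitzIntegrand ħ φ a ψ) volume := by
  have h1 : Integrable (fun z => a z * inner ℂ (displace ħ z φ) ψ) volume :=
    ha.integrable_mul (memLp_inner_displace hħ φ ψ)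
  refine (h1.norm.mul_const ‖φ‖).mono' (h1.1.smul (continuous_displace ħ φ).aestronglyMeasurable)
    (Filter.Eventually.of_forall fun z => ?_)
  rw [toeplitzIntegrand, norm_smul, norm_displace]

/-! ### Metaplectic covariance of displacements -/

theorem unitary_mul_apply (U V : Unitaries ι) (f : L2 ι) : (U * V) f = U (V f) := rfl

theorem unitary_one_apply (f : L2 ι) : (1 : Unitaries ι) f = f := rfl

theorem act_zero {κ : Type*} [Fintype κ] (v : EuclideanSpace ℝ κ) :
    act (0 : Matrix κ κ ℝ) v = 0 := by
  ext i
  simp [act]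

theorem act_neg {κ : Type*} [Fintype κ] (A : Matrix κ κ ℝ) (v : EuclideanSpace ℝ κ) :
    act (-A) v = -act A v := by
  ext i
  simp [act, Matrix.neg_mulVec]

/-- The integral formula for Ĵ is available only on L¹ ∩ L²; density, from Schwartz functions,
extends its consequences to L². -/
theorem dense_integrable : Dense {f : L2 ι | Integrable f volume} := by
  refine (SchwartzMap.denseRange_toLpCLM (E := Config ι) (F := ℂ) (p := 2) (μ := volume)
    ENNReal.ofNat_ne_top).mono ?_
  rintro _ ⟨φ, rfl⟩
  exact φ.integrable.congr (φ.coeFn_toLp 2 volume).symm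

theorem integrable_displace (ħ : ℝ) (z : Phase ι) {φ : L2 ι} (hφ : Integrable φ volume) :
    Integrable (displace ħ z φ) volume := by
  refine Integrable.congr ?_ (coeFn_displace ħ z φ).symm
  have h1 : Integrable (fun x => φ (x - pos z)) volume := hφ.comp_sub_right (pos z)
  refine h1.mono ?_ (Filter.Eventually.of_forall fun x => ?_)
  · refine AEStronglyMeasurable.mul (Continuous.aestronglyMeasurable ?_) h1.1
    fun_prop
  · rw [displaceFun, norm_mul, norm_displacePhase, one_mul]

theorem IsJHat.apply_displace_of_integrable [DecidableEq ι] {ħ : ℝ} {U : Unitaries ι} (hU : IsJHat ħ U)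
    (z : Phase ι) {φ : L2 ι} (hφ : Integrable φ volume) :
    U (displace ħ z φ) = displace ħ (act (stdJ ι) z) (U φ) := by
  have hz : act (stdJ ι) z = phasePoint (mom z) (-pos z) := by
    rw [stdJ, act_fromBlocks]
    simp [act_zero, act_one, act_neg]
  refine Lp.ext ?_
  filter_upwards [hU _ (integrable_displace ħ z hφ), coeFn_displace ħ (act (stdJ ι) z) (U φ),
    (measurePreserving_sub_right volume (mom z)).quasiMeasurePreserving.ae (hU φ hφ)]
    with x h1 h2 h3
  rw [h1, h2, hz, displaceFun, pos_phasePoint, mom_phasePoint, h3, mul_left_comm]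
  congr 1
  -- Shifting the integration variable by the position of z makes both integrands carry φ at the
  -- same point; only the exponents remain to be compared.
  rw [← integral_const_mul, ← integral_sub_right_eq_self
    (fun x' => Complex.exp _ * (Complex.exp _ * φ x')) (pos z)]
  refine integral_congr_ae ?_
  filter_upwards [coeFn_displace ħ z φ] with x' h4
  rw [h4, displaceFun, ← mul_assoc, ← mul_assoc, ← Complex.exp_add, ← Complex.exp_add]
  congr 2
  simp only [inner_sub_left, inner_sub_right, inner_neg_left]
  rw [real_inner_comm x (pos z), real_inner_comm (mom z) (pos z)]
  push_cast
  ring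

theorem IsJHat.apply_displace [DecidableEq ι] {ħ : ℝ} {U : Unitaries ι} (hU : IsJHat ħ U)
    (z : Phase ι) (φ : L2 ι) :
    U (displace ħ z φ) = displace ħ (act (stdJ ι) z) (U φ) := by
  have h : (fun f => U (displaceU ħ z f)) = fun f => displaceU ħ (act (stdJ ι) z) (U f) :=
    Continuous.ext_on dense_integrable (by fun_prop) (by fun_prop) fun f hf => by
      simpa using hU.apply_displace_of_integrable z hf
  simpa using congrFun h φ

/-- Expanding the quadratic phase at x - x₀, the two cross terms agree by symmetry of P and shift
the momentum by -P x₀. -/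
theorem IsVHat.apply_displace [DecidableEq ι] {ħ : ℝ} {P : Matrix ι ι ℝ} (hP : P.IsSymm)
    {U : Unitaries ι} (hU : IsVHat ħ P U) (z : Phase ι) (φ : L2 ι) :
    U (displace ħ z φ) = displace ħ (act (Matrix.fromBlocks 1 0 (-P) 1) z) (U φ) := by
  refine Lp.ext ?_
  filter_upwards [hU (displace ħ z φ), coeFn_displace ħ z φ,
    coeFn_displace ħ (act (Matrix.fromBlocks 1 0 (-P) 1) z) (U φ),
    (measurePreserving_sub_right volume (pos z)).quasiMeasurePreserving.ae (hU φ)]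
    with x h1 h2 h3 h4
  rw [h1, h2, h3, act_fromBlocks]
  simp only [displaceFun, pos_phasePoint, mom_phasePoint, act_one, act_zero, add_zero, act_neg]
  rw [h4, ← mul_assoc, ← mul_assoc, ← Complex.exp_add, ← Complex.exp_add]
  congr 2
  rw [act_sub]
  simp only [inner_sub_left, inner_sub_right, inner_add_left, inner_neg_left]
  rw [inner_act_comm hP x (pos z)]
  push_cast
  ring

theorem IsMHat.apply_displace [DecidableEq ι] (ħ : ℝ) {L : Matrix ι ι ℝ} (hL : L.det ≠ 0) {m : ℤ}
    {U : Unitaries ι} (hU : IsMHat L m U) (z : Phase ι) (φ : L2 ι) :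
    U (displace ħ z φ) = displace ħ (act (Matrix.fromBlocks L⁻¹ 0 0 L.transpose) z) (U φ) := by
  have hinv (v : Config ι) : act L (act L⁻¹ v) = v := by
    rw [act_act, Matrix.mul_nonsing_inv _ (Ne.isUnit hL), act_one]
  refine Lp.ext ?_
  filter_upwards [hU (displace ħ z φ),
    (quasiMeasurePreserving_act hL).ae (coeFn_displace ħ z φ),
    coeFn_displace ħ (act (Matrix.fromBlocks L⁻¹ 0 0 L.transpose) z) (U φ),
    (measurePreserving_sub_right volume (act L⁻¹ (pos z))).quasiMeasurePreserving.ae (hU φ)]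
    with x h1 h2 h3 h4
  rw [h1, h2, h3, act_fromBlocks]
  simp only [displaceFun, pos_phasePoint, mom_phasePoint, act_zero, add_zero, zero_add]
  rw [h4, act_sub, hinv, inner_act_transpose, inner_act_transpose, hinv]
  ring

theorem metaplecticGenerators_displace [DecidableEq ι] {ħ : ℝ}
    {w : Unitaries ι × Matrix.symplecticGroup ι ℝ} (hw : w ∈ metaplecticGenerators ι ħ)
    (z : Phase ι) (φ : L2 ι) :
    w.1 (displace ħ z φ) = displace ħ (act (w.2 : Matrix (ι ⊕ ι) (ι ⊕ ι) ℝ) z) (w.1 φ) := by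
  rcases hw with (⟨h1, h2⟩ | ⟨P, hP, h1, h2⟩) | ⟨L, m, hL, h1, h2⟩
  · rw [h2, h1.apply_displace]
  · rw [h2, h1.apply_displace hP]
  · rw [h2, h1.apply_displace ħ (fun h => by simp [h] at hL)]

/-- Metaplectic operators intertwine displacements. -/
theorem Covers.apply_displace [DecidableEq ι] {ħ : ℝ} {U : Unitaries ι}
    {S : Matrix.symplecticGroup ι ℝ} (h : Covers ħ U S) (z : Phase ι) (φ : L2 ι) :
    U (displace ħ z φ) = displace ħ (act (S : Matrix (ι ⊕ ι) (ι ⊕ ι) ℝ) z) (U φ) := by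
  have key : ∀ w ∈ metaplecticGraph ι ħ, ∀ (z : Phase ι) (φ : L2 ι),
      w.1 (displace ħ z φ) =
        displace ħ (act (w.2 : Matrix (ι ⊕ ι) (ι ⊕ ι) ℝ) z) (w.1 φ) := by
    intro w hw
    induction hw using Subgroup.closure_induction with
    | mem x hx => exact metaplecticGenerators_displace hx
    | one => intro z φ; simp [act_one]
    | mul x y _ _ hx hy =>
      intro z φ
      rw [Prod.fst_mul, unitary_mul_apply, hy, hx, unitary_mul_apply,
        Prod.snd_mul, Submonoid.coe_mul, act_act]
    | inv x _ hx =>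
      intro z φ
      -- The intertwining relation for the inverse is the one for x read at the preimages of z and
      -- φ.
      have h1 := hx (act ((x.2⁻¹ : Matrix.symplecticGroup ι ℝ) : Matrix (ι ⊕ ι) (ι ⊕ ι) ℝ) z)
        (x.1⁻¹ φ)
      rw [act_act, ← Submonoid.coe_mul, mul_inv_cancel, Submonoid.coe_one, act_one,
        ← unitary_mul_apply, mul_inv_cancel, unitary_one_apply] at h1
      rw [← h1, Prod.fst_inv, Prod.snd_inv, ← unitary_mul_apply, inv_mul_cancel,
        unitary_one_apply]
  exact key (U, S) h z φ

/-- Two metaplectic operators covering the same symplectic matrix agree on a state up to a phase. -/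
theorem Covers.exists_smul_eq [DecidableEq ι] {ħ : ℝ} (hħ : ħ ≠ 0) {U V : Unitaries ι}
    {S : Matrix.symplecticGroup ι ℝ} (hU : Covers ħ U S) (hV : Covers ħ V S) (φ : L2 ι) :
    ∃ c : ℂ, ‖c‖ = 1 ∧ V φ = c • U φ := by
  refine exists_smul_eq_of_ambiguity_eq hħ (by simp) fun z => ?_
  -- By unitarity the ambiguity function of Uφ at Sz equals that of φ at z, so it depends on U only
  -- through S.
  have h1 : act (S : Matrix (ι ⊕ ι) (ι ⊕ ι) ℝ)
      (act ((S⁻¹ : Matrix.symplecticGroup ι ℝ) : Matrix (ι ⊕ ι) (ι ⊕ ι) ℝ) z) = z := by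
    rw [act_act, ← Submonoid.coe_mul, mul_inv_cancel, Submonoid.coe_one, act_one]
  rw [← h1, ← hU.apply_displace, ← hV.apply_displace, LinearIsometryEquiv.inner_map_map,
    LinearIsometryEquiv.inner_map_map]

/-- A metaplectic operator is determined by its projection and its value on one almost everywhere
nonzero state. -/
theorem Covers.unique [DecidableEq ι] {ħ : ℝ} (hħ : ħ ≠ 0) {U V : Unitaries ι}
    {S : Matrix.symplecticGroup ι ℝ} (hU : Covers ħ U S) (hV : Covers ħ V S) {φ : L2 ι}
    (hφ : ∀ᵐ x, φ x ≠ 0) (h : U φ = V φ) : U = V :=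
  unitary_ext_of_displace hħ hφ fun z => by rw [hU.apply_displace, hV.apply_displace, h]

/-! ### The Fourier transform as a metaplectic operator -/

-- Ĵ is the L² Fourier transform followed by the dilation by (2πħ)⁻¹; the modulus of the prefactor
-- is exactly what makes this weighted dilation unitary.
open scoped FourierTransform in
theorem exists_isJHat {ħ : ℝ} (hħ : 0 < ħ) : ∃ U : Unitaries ι, IsJHat ħ U := by
  set C₀ : ℂ := (1 / (2 * Real.pi * Complex.I * ħ) : ℂ) ^ ((Fintype.card ι : ℂ) / 2) with hC₀
  have hs : 0 < (2 * Real.pi * ħ)⁻¹ := by positivity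
  have hnorm : ‖C₀‖ = (2 * Real.pi * ħ)⁻¹ ^ ((Fintype.card ι : ℝ) / 2) := by
    have h1 : ((Fintype.card ι : ℂ) / 2) = (((Fintype.card ι : ℝ) / 2 : ℝ) : ℂ) := by push_cast; rfl
    rw [hC₀, h1, Complex.norm_cpow_real]
    congr 1
    simp [abs_of_pos hħ, abs_of_pos Real.pi_pos]
  have hpos : 0 < ‖C₀‖ := by rw [hnorm]; positivity
  have hsq : (‖C₀‖ ^ 2)⁻¹ = |((2 * Real.pi * ħ)⁻¹ ^ Module.finrank ℝ (Config ι))⁻¹| := by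
    rw [abs_of_pos (by positivity), hnorm, ← Real.rpow_natCast, ← Real.rpow_mul hs.le,
      finrank_euclideanSpace, ← Real.rpow_natCast]
    congr 2
    push_cast
    ring
  obtain ⟨D, hD⟩ := exists_unitary_weighted_comp (w := fun _ : Config ι => C₀) measurable_const
    (Homeomorph.smulOfNeZero (2 * Real.pi * ħ)⁻¹ hs.ne').toMeasurableEquiv hpos (fun _ => rfl)
    (by
      rw [hsq]
      exact Measure.map_addHaar_smul volume hs.ne')
  refine ⟨(Lp.fourierTransformₗᵢ (Config ι) ℂ).trans D, fun ψ hψ => ?_⟩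
  have hq : Measure.QuasiMeasurePreserving
      (fun x : Config ι => (2 * Real.pi * ħ)⁻¹ • x) volume volume :=
    ⟨measurable_const_smul _, by
      rw [Measure.map_addHaar_smul volume hs.ne']; exact Measure.smul_absolutelyContinuous⟩
  filter_upwards [hD (Lp.fourierTransformₗᵢ (Config ι) ℂ ψ),
    hq.ae (coeFn_fourierTransformₗᵢ ψ hψ)] with x h1 h2
  rw [LinearIsometryEquiv.trans_apply, h1]
  change C₀ * (Lp.fourierTransformₗᵢ (Config ι) ℂ ψ : Config ι → ℂ) ((2 * Real.pi * ħ)⁻¹ • x) = _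
  rw [h2, Real.fourier_eq]
  congr 2
  ext y
  rw [Circle.smul_def, Real.fourierChar_apply, smul_eq_mul, inner_smul_right, real_inner_comm]
  congr 2
  push_cast
  have : (Real.pi : ℂ) ≠ 0 := by exact_mod_cast Real.pi_ne_zero
  have : (ħ : ℂ) ≠ 0 := by exact_mod_cast hħ.ne'
  field_simp

/-! ### Metaplectic operators on diagonal Gaussians -/

/-- The Gaussian `K exp(-∑ bᵢ xᵢ²)`. -/
def diagGaussian (K : ℂ) (b : ι → ℂ) (x : Config ι) : ℂ :=
  K * Complex.exp (-∑ i, b i * (x i : ℂ) ^ 2)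

theorem integrable_diagGaussian (K : ℂ) {b : ι → ℂ} (hb : ∀ i, 0 < (b i).re) :
    Integrable (diagGaussian K b) volume := by
  have h := (GaussianFourier.integrable_cexp_neg_sum_mul_add hb 0).const_mul K
  rw [← (PiLp.volume_preserving_toLp ι).integrable_comp_emb
    (MeasurableEquiv.toLp 2 _).measurableEmbedding]
  simpa [Function.comp_def, diagGaussian] using h

theorem memLp_diagGaussian (K : ℂ) {b : ι → ℂ} (hb : ∀ i, 0 < (b i).re) :
    MemLp (diagGaussian K b) 2 volume := by
  rw [memLp_two_iff_integrable_sq_norm (integrable_diagGaussian K hb).1]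
  refine (integrable_diagGaussian (K ^ 2) (b := fun i => 2 * b i)
    fun i => by simpa using hb i).norm.congr (Filter.Eventually.of_forall fun x => ?_)
  simp only [diagGaussian]
  rw [← norm_pow, mul_pow, ← Complex.exp_nat_mul]
  congr 3
  push_cast
  rw [mul_neg, Finset.mul_sum]
  simp_rw [mul_assoc]

theorem inner_act_diagonal [DecidableEq ι] (p : ι → ℝ) (x : Config ι) :
    inner ℝ (act (Matrix.diagonal p) x) x = ∑ i, p i * x i ^ 2 := by
  rw [inner_act, dotProduct]
  refine Finset.sum_congr rfl fun i _ => ?_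
  rw [Matrix.mulVec_diagonal]
  ring

theorem IsVHat.diagGaussian [DecidableEq ι] {ħ : ℝ} {p : ι → ℝ} {U : Unitaries ι}
    (hU : IsVHat ħ (Matrix.diagonal p) U) {f : L2 ι} {K : ℂ} {b : ι → ℂ}
    (hf : f =ᵐ[volume] diagGaussian K b) :
    U f =ᵐ[volume] diagGaussian K fun i => b i + Complex.I / (2 * ħ) * p i := by
  filter_upwards [hU f, hf] with x h1 h2
  rw [h1, h2, BlobQuantization.diagGaussian, BlobQuantization.diagGaussian, mul_left_comm,
    ← Complex.exp_add, inner_act_diagonal]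
  congr 2
  push_cast
  simp only [add_mul, Finset.sum_add_distrib, Finset.mul_sum]
  rw [neg_add, add_comm, ← Finset.sum_neg_distrib, ← Finset.sum_neg_distrib]
  congr 1
  exact Finset.sum_congr rfl fun i _ => by ring

theorem IsMHat.diagGaussian [DecidableEq ι] {l : ι → ℝ} (hl : ∀ i, 0 < l i) {U : Unitaries ι}
    (hU : IsMHat (Matrix.diagonal l) 0 U) {f : L2 ι} {K : ℂ} {b : ι → ℂ}
    (hf : f =ᵐ[volume] diagGaussian K b) :
    U f =ᵐ[volume] diagGaussian (K * ∏ i, ((Real.sqrt (l i) : ℝ) : ℂ))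
      fun i => b i * (l i : ℂ) ^ 2 := by
  have hdet : (Matrix.diagonal l).det ≠ 0 := by
    rw [Matrix.det_diagonal]
    exact Finset.prod_ne_zero_iff.2 fun i _ => (hl i).ne'
  filter_upwards [hU f, (quasiMeasurePreserving_act hdet).ae hf] with x h1 h2
  have h3 (i : ι) : act (Matrix.diagonal l) x i = l i * x i := by
    simp [act, Matrix.mulVec_diagonal]
  rw [h1, h2, BlobQuantization.diagGaussian, BlobQuantization.diagGaussian, Matrix.det_diagonal,
    abs_of_pos (Finset.prod_pos fun i _ => hl i), Real.sqrt_prod _ fun i _ => (hl i).le]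
  simp only [h3, zpow_zero, one_mul, Complex.ofReal_prod, Complex.ofReal_mul]
  rw [← mul_assoc, mul_comm K]
  congr 3
  exact Finset.sum_congr rfl fun i _ => by ring

theorem IsJHat.diagGaussian {ħ : ℝ} {U : Unitaries ι} (hU : IsJHat ħ U) {f : L2 ι} {K : ℂ}
    {b : ι → ℂ} (hb : ∀ i, 0 < (b i).re) (hf : f =ᵐ[volume] diagGaussian K b) :
    U f =ᵐ[volume] diagGaussian
      (K * ∏ i, ((1 / (2 * Real.pi * Complex.I * ħ) : ℂ) ^ (1 / 2 : ℂ) *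
        (Real.pi / b i) ^ (1 / 2 : ℂ)))
      fun i => 1 / (4 * ħ ^ 2 * b i) := by
  filter_upwards [hU f ((integrable_diagGaussian K hb).congr hf.symm)] with x h1
  have h2 : ∫ x', Complex.exp (-(Complex.I / ħ) * ((inner ℝ x x' : ℝ) : ℂ)) * f x'
      = K * ∏ i, (Real.pi / b i) ^ (1 / 2 : ℂ) *
        Complex.exp ((-(Complex.I / ħ) * x i) ^ 2 / (4 * b i)) := by
    rw [← GaussianFourier.integral_cexp_neg_sum_mul_add hb fun i => -(Complex.I / ħ) * x i,
      ← integral_const_mul, ← (PiLp.volume_preserving_toLp ι).integral_comp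
        (MeasurableEquiv.toLp 2 _).measurableEmbedding]
    have h3 := (PiLp.volume_preserving_toLp ι).quasiMeasurePreserving.ae hf
    refine integral_congr_ae ?_
    filter_upwards [h3] with v hv
    rw [hv, BlobQuantization.diagGaussian, mul_left_comm, ← Complex.exp_add, add_comm]
    congr 3
    simp [PiLp.inner_apply, Finset.mul_sum, mul_comm, mul_left_comm]
  -- Splitting the power n/2 into one principal square root per coordinate lets phases be computed
  -- coordinatewise.
  have h4 : ((1 / (2 * Real.pi * Complex.I * ħ) : ℂ) ^ ((Fintype.card ι : ℂ) / 2))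
      = ∏ _i : ι, (1 / (2 * Real.pi * Complex.I * ħ) : ℂ) ^ (1 / 2 : ℂ) := by
    rw [Finset.prod_const, ← Complex.cpow_nat_mul, Finset.card_univ, mul_one_div]
  rw [h1, h2, h4, BlobQuantization.diagGaussian, Finset.prod_mul_distrib, Finset.prod_mul_distrib,
    ← Complex.exp_sum]
  have h5 : ∑ i, (-(Complex.I / ħ) * (x i : ℂ)) ^ 2 / (4 * b i)
      = -∑ i, 1 / (4 * ħ ^ 2 * b i) * (x i : ℂ) ^ 2 := by
    rw [← Finset.sum_neg_distrib]
    refine Finset.sum_congr rfl fun i _ => ?_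
    have : (-(Complex.I / ħ) * (x i : ℂ)) ^ 2 = Complex.I ^ 2 * (x i : ℂ) ^ 2 / (ħ : ℂ) ^ 2 := by
      ring
    rw [this, Complex.I_sq]
    ring
  rw [h5]
  ring

/-! ### Rotations -/

theorem exp_cpow_of_im_mem {u : ℂ} (h1 : -Real.pi < u.im) (h2 : u.im ≤ Real.pi) (y : ℂ) :
    Complex.exp u ^ y = Complex.exp (u * y) := by
  rw [Complex.cpow_def_of_ne_zero (Complex.exp_ne_zero _), Complex.log_exp h1 h2]

theorem sin_sub_cos_ne_zero {θ : ℝ} (hs : 0 < Real.sin θ) :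
    (Real.sin θ - Complex.I * Real.cos θ : ℂ) ≠ 0 := by
  intro h
  have := congrArg Complex.re h
  simp [-Complex.ofReal_sin, -Complex.ofReal_cos] at this
  exact hs.ne' this

theorem rotation_denominator {ħ θ : ℝ} (hħ : 0 < ħ) (hs : 0 < Real.sin θ) :
    (1 / (2 * ħ) + Complex.I / (2 * ħ) * ((-(Real.cos θ / Real.sin θ) : ℝ) : ℂ) : ℂ)
      = (Real.sin θ - Complex.I * Real.cos θ) / (2 * ħ * Real.sin θ) := by
  have hsC : (Real.sin θ : ℂ) ≠ 0 := by exact_mod_cast hs.ne'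
  have hħC : (ħ : ℂ) ≠ 0 := by exact_mod_cast hħ.ne'
  rw [Complex.ofReal_neg, Complex.ofReal_div]
  field_simp
  ring

/-- The constants picked up in one coordinate. The bases under the square roots have arguments -π/2
and π/2 - θ, whose half sum is -θ/2, and all moduli cancel. For 0 < θ < π, sin θ > 0 and both
arguments lie in the principal range. -/
theorem rotation_phase {ħ θ : ℝ} (hħ : 0 < ħ) (h0 : 0 < θ) (hπ : θ < Real.pi) :
    (1 / (2 * Real.pi * Complex.I * ħ) : ℂ) ^ (1 / 2 : ℂ) *
      (Real.pi / (1 / (2 * ħ) + Complex.I / (2 * ħ) * ((-(Real.cos θ / Real.sin θ) : ℝ) : ℂ)))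
        ^ (1 / 2 : ℂ) * ((Real.sqrt (1 / Real.sin θ) : ℝ) : ℂ)
      = Complex.exp (-(Complex.I / 2) * θ) := by
  have hs : 0 < Real.sin θ := Real.sin_pos_of_pos_of_lt_pi h0 hπ
  have hk : 0 < 2 * Real.pi * ħ := by positivity
  have hsC : (Real.sin θ : ℂ) ≠ 0 := by exact_mod_cast hs.ne'
  have hħC : (ħ : ℂ) ≠ 0 := by exact_mod_cast hħ.ne'
  have hπC : (Real.pi : ℂ) ≠ 0 := by exact_mod_cast Real.pi_ne_zero
  have hsc : (Real.sin θ : ℂ) ^ 2 + (Real.cos θ : ℂ) ^ 2 = 1 := by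
    exact_mod_cast Real.sin_sq_add_cos_sq θ
  have e1 : (1 / (2 * Real.pi * Complex.I * ħ) : ℂ)
      = Complex.exp (-(Real.log (2 * Real.pi * ħ) : ℝ) + ((-(Real.pi / 2) : ℝ) : ℂ) * Complex.I) := by
    rw [Complex.exp_add, Complex.exp_neg, ← Complex.ofReal_exp, Real.exp_log hk]
    push_cast
    rw [neg_mul, Complex.exp_neg, Complex.exp_pi_div_two_mul_I]
    field_simp
  have e2 : (Real.pi / (1 / (2 * ħ) + Complex.I / (2 * ħ) *
      ((-(Real.cos θ / Real.sin θ) : ℝ) : ℂ)) : ℂ)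
      = Complex.exp (((Real.log (2 * Real.pi * ħ) + Real.log (Real.sin θ) : ℝ) : ℂ) +
        ((Real.pi / 2 - θ : ℝ) : ℂ) * Complex.I) := by
    rw [Complex.exp_add, ← Complex.ofReal_exp, Real.exp_add, Real.exp_log hk, Real.exp_log hs,
      Complex.exp_mul_I, ← Complex.ofReal_cos, ← Complex.ofReal_sin, Real.cos_pi_div_two_sub,
      Real.sin_pi_div_two_sub]
    rw [rotation_denominator hħ hs, div_div_eq_mul_div, div_eq_iff (sin_sub_cos_ne_zero hs)]
    push_cast at hsc ⊢
    linear_combination (-(2 * Real.pi * ħ * Complex.sin θ) : ℂ) * hsc +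
      (2 * Real.pi * ħ * Complex.sin θ * Complex.cos θ ^ 2 : ℂ) * Complex.I_sq
  have e3 : ((Real.sqrt (1 / Real.sin θ) : ℝ) : ℂ)
      = Complex.exp (-(1 / 2) * (Real.log (Real.sin θ) : ℝ)) := by
    rw [Real.sqrt_eq_rpow, one_div, Real.inv_rpow hs.le, Real.rpow_def_of_pos hs, ← Real.exp_neg,
      Complex.ofReal_exp]
    congr 1
    push_cast
    ring
  have hp := Real.pi_pos
  rw [e1, e2, e3, exp_cpow_of_im_mem, exp_cpow_of_im_mem, ← Complex.exp_add, ← Complex.exp_add]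
  · congr 1
    push_cast
    ring
  all_goals
    simp only [Complex.add_im, Complex.neg_im, Complex.ofReal_im,
      Complex.im_ofReal_mul, Complex.I_im]
    linarith

/-- As (sin θ - i cos θ)⁻¹ = sin θ + i cos θ, the exponent after Fourier transform and dilation has
real part 1/(2ħ), and the last shear cancels its imaginary part. -/
theorem rotation_exponent {ħ θ : ℝ} (hħ : 0 < ħ) (h0 : 0 < θ) (hπ : θ < Real.pi) :
    1 / (4 * ħ ^ 2 * (1 / (2 * ħ) + Complex.I / (2 * ħ) *
      ((-(Real.cos θ / Real.sin θ) : ℝ) : ℂ))) * ((1 / Real.sin θ : ℝ) : ℂ) ^ 2 +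
      Complex.I / (2 * ħ) * ((-(Real.cos θ / Real.sin θ) : ℝ) : ℂ) = 1 / (2 * ħ) := by
  have hs : 0 < Real.sin θ := Real.sin_pos_of_pos_of_lt_pi h0 hπ
  have hsC : (Real.sin θ : ℂ) ≠ 0 := by exact_mod_cast hs.ne'
  have hħC : (ħ : ℂ) ≠ 0 := by exact_mod_cast hħ.ne'
  have hsc : (Real.sin θ : ℂ) ^ 2 + (Real.cos θ : ℂ) ^ 2 = 1 := by
    exact_mod_cast Real.sin_sq_add_cos_sq θ
  have h5 : (Real.sin θ - Complex.I * Real.cos θ : ℂ)⁻¹ = Real.sin θ + Complex.I * Real.cos θ := by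
    refine inv_eq_of_mul_eq_one_right ?_
    linear_combination hsc - (Real.cos θ : ℂ) ^ 2 * Complex.I_sq
  rw [rotation_denominator hħ hs, Complex.ofReal_neg, Complex.ofReal_div, Complex.ofReal_div,
    Complex.ofReal_one]
  calc _ = (Real.sin θ - Complex.I * Real.cos θ : ℂ)⁻¹ / (2 * ħ * Real.sin θ)
        - Complex.I * Real.cos θ / (2 * ħ * Real.sin θ) := by
        have := sin_sub_cos_ne_zero hs
        field_simp
        ring
    _ = _ := by
        rw [h5]
        field_simp
        ring

/-! ### Coverings by generators and metaplectic rotations. -/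

variable [DecidableEq ι]

theorem stdJ_mem : stdJ ι ∈ Matrix.symplecticGroup ι ℝ := by
  rw [stdJ, SymplecticGroup.fromBlocks_mem_iff]
  simp

theorem shear_mem {P : Matrix ι ι ℝ} (hP : P.IsSymm) :
    Matrix.fromBlocks 1 0 (-P) 1 ∈ Matrix.symplecticGroup ι ℝ := by
  rw [SymplecticGroup.fromBlocks_mem_iff]
  simp [hP.eq]

theorem dilation_mem {L : Matrix ι ι ℝ} (hL : L.det ≠ 0) :
    Matrix.fromBlocks L⁻¹ 0 0 L.transpose ∈ Matrix.symplecticGroup ι ℝ := by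
  rw [SymplecticGroup.fromBlocks_mem_iff]
  simp [← Matrix.transpose_mul, Matrix.mul_nonsing_inv _ (Ne.isUnit hL)]

theorem IsJHat.covers {ħ : ℝ} {U : Unitaries ι} (hU : IsJHat ħ U) :
    Covers ħ U ⟨stdJ ι, stdJ_mem⟩ :=
  Subgroup.subset_closure (Or.inl (Or.inl ⟨hU, rfl⟩))

theorem IsVHat.covers {ħ : ℝ} {P : Matrix ι ι ℝ} (hP : P.IsSymm) {U : Unitaries ι}
    (hU : IsVHat ħ P U) : Covers ħ U ⟨_, shear_mem hP⟩ :=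
  Subgroup.subset_closure (Or.inl (Or.inr ⟨P, hP, hU, rfl⟩))

theorem IsMHat.covers (ħ : ℝ) {L : Matrix ι ι ℝ} {m : ℤ} (hL : 0 < (-1 : ℝ) ^ m * L.det)
    (hL0 : L.det ≠ 0) {U : Unitaries ι} (hU : IsMHat L m U) :
    Covers ħ U ⟨_, dilation_mem hL0⟩ :=
  Subgroup.subset_closure (Or.inr ⟨L, m, hL, hU, rfl⟩)

theorem Covers.mul {ħ : ℝ} {U V : Unitaries ι} {S T : Matrix.symplecticGroup ι ℝ}
    (hU : Covers ħ U S) (hV : Covers ħ V T) : Covers ħ (U * V) (S * T) :=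
  (metaplecticGraph ι ħ).mul_mem hU hV

theorem Covers.inv {ħ : ℝ} {U : Unitaries ι} {S : Matrix.symplecticGroup ι ℝ}
    (hU : Covers ħ U S) : Covers ħ U⁻¹ S⁻¹ :=
  (metaplecticGraph ι ħ).inv_mem hU

theorem Covers.one (ħ : ℝ) : Covers ħ (1 : Unitaries ι) 1 := (metaplecticGraph ι ħ).one_mem

/-- The rotation by the angle `θᵢ` in the plane of `xᵢ` and `pᵢ`. -/
def rotationMatrix (θ : ι → ℝ) : Matrix (ι ⊕ ι) (ι ⊕ ι) ℝ :=
  Matrix.fromBlocks (Matrix.diagonal fun i => Real.cos (θ i))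
    (Matrix.diagonal fun i => Real.sin (θ i))
    (-Matrix.diagonal fun i => Real.sin (θ i)) (Matrix.diagonal fun i => Real.cos (θ i))

/-- Since the upper right block, diag(sin θᵢ), is invertible, the rotation factors as shear,
dilation, J, shear. Each factor is the projection of a generator. -/
theorem rotationMatrix_eq {θ : ι → ℝ} (hs : ∀ i, Real.sin (θ i) ≠ 0) :
    rotationMatrix θ =
      Matrix.fromBlocks 1 0
        (-Matrix.diagonal fun i => -(Real.cos (θ i) / Real.sin (θ i))) 1 *
      (Matrix.fromBlocks (Matrix.diagonal fun i => 1 / Real.sin (θ i))⁻¹ 0 0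
        (Matrix.diagonal fun i => 1 / Real.sin (θ i)).transpose *
      (stdJ ι * Matrix.fromBlocks 1 0
        (-Matrix.diagonal fun i => -(Real.cos (θ i) / Real.sin (θ i))) 1)) := by
  have hinv : (Matrix.diagonal fun i => 1 / Real.sin (θ i))⁻¹
      = Matrix.diagonal fun i => Real.sin (θ i) := by
    refine Matrix.inv_eq_right_inv ?_
    rw [Matrix.diagonal_mul_diagonal, ← Matrix.diagonal_one]
    congr 1
    ext i
    field_simp [hs i]
  rw [hinv, stdJ, rotationMatrix]
  simp only [Matrix.fromBlocks_multiply, Matrix.diagonal_transpose, Matrix.diagonal_neg,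
    Matrix.diagonal_mul_diagonal, Matrix.diagonal_add, Matrix.mul_zero, Matrix.zero_mul,
    Matrix.one_mul, Matrix.mul_one, zero_add, add_zero, Matrix.mul_neg, neg_neg,
    neg_zero]
  congr 1
  · congr 1
    ext i
    have := hs i
    field_simp
  · congr 1
    ext i
    have := hs i
    have h1 := Real.sin_sq_add_cos_sq (θ i)
    field_simp
    linarith
  · congr 1
    ext i
    have := hs i
    field_simp

/-- The ground state `x ↦ exp(-x·x / (2ħ))` of the standard oscillator is an eigenvector of
metaplectic rotations. -/
theorem exists_covers_rotation {ħ : ℝ} (hħ : 0 < ħ) {θ : ι → ℝ} (h0 : ∀ i, 0 < θ i)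
    (hπ : ∀ i, θ i < Real.pi) {f : L2 ι}
    (hf : f =ᵐ[volume] diagGaussian 1 fun _ => 1 / (2 * ħ)) :
    ∃ (U : Unitaries ι) (S : Matrix.symplecticGroup ι ℝ), Covers ħ U S ∧
      (S : Matrix (ι ⊕ ι) (ι ⊕ ι) ℝ) = rotationMatrix θ ∧
      U f = Complex.exp (-(Complex.I / 2) * ∑ i, (θ i : ℂ)) • f := by
  have hs (i : ι) : 0 < Real.sin (θ i) := Real.sin_pos_of_pos_of_lt_pi (h0 i) (hπ i)
  set p : ι → ℝ := fun i => -(Real.cos (θ i) / Real.sin (θ i)) with hp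
  set l : ι → ℝ := fun i => 1 / Real.sin (θ i) with hl
  have hlpos (i : ι) : 0 < l i := one_div_pos.2 (hs i)
  have hdet : 0 < (Matrix.diagonal l).det := by
    rw [Matrix.det_diagonal]
    exact Finset.prod_pos fun i _ => hlpos i
  obtain ⟨V, hV⟩ := exists_isVHat ħ (Matrix.diagonal p)
  obtain ⟨M, hM⟩ := exists_isMHat hdet.ne' 0
  obtain ⟨J, hJ⟩ := exists_isJHat (ι := ι) hħ
  have hP : (Matrix.diagonal p).IsSymm := Matrix.isSymm_diagonal p
  refine ⟨V * (M * (J * V)), _, (hV.covers hP).mul ((hM.covers ħ (by simpa using hdet)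
    hdet.ne').mul (hJ.covers.mul (hV.covers hP))), ?_, ?_⟩
  · rw [rotationMatrix_eq fun i => (hs i).ne']
    rfl
  · have hb (i : ι) : 0 < ((1 / (2 * ħ) + Complex.I / (2 * ħ) * p i : ℂ)).re := by
      have h1 : (1 / (2 * ħ) + Complex.I / (2 * ħ) * p i : ℂ)
          = ((1 / (2 * ħ) : ℝ) : ℂ) + ((p i / (2 * ħ) : ℝ) : ℂ) * Complex.I := by
        push_cast; ring
      rw [h1, Complex.add_re, Complex.ofReal_re, Complex.re_ofReal_mul, Complex.I_re, mul_zero,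
        add_zero]
      positivity
    -- Each generator keeps the state a diagonal Gaussian; the accumulated constant and exponents
    -- are evaluated by `rotation_phase` and `rotation_exponent`.
    have h1 := hV.diagGaussian (hM.diagGaussian hlpos (hJ.diagGaussian hb (hV.diagGaussian hf)))
    refine Lp.ext ?_
    filter_upwards [h1, Lp.coeFn_smul (Complex.exp (-(Complex.I / 2) * ∑ i, (θ i : ℂ))) f, hf]
      with x h2 h3 h4
    rw [h3, Pi.smul_apply, h4, smul_eq_mul, unitary_mul_apply, unitary_mul_apply,
      unitary_mul_apply, h2, one_mul, ← Finset.prod_mul_distrib]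
    have h5 (i : ι) := rotation_phase hħ (h0 i) (hπ i)
    have h6 (i : ι) := rotation_exponent hħ (h0 i) (hπ i)
    simp only [hp, hl, diagGaussian, h5, h6]
    rw [← Complex.exp_sum, Finset.mul_sum, one_mul]

/-! ### The canonical group in normal form -/

/-- With X = O diag(d) Oᵀ, take L = diag(√d) Oᵀ. The product LᵀL = X gives the Gaussian its width,
while diagonality of LLᵀ decouples the oscillators. -/
theorem exists_transpose_mul_self {X : Matrix ι ι ℝ} (hX : X.PosDef) :
    ∃ (L : Matrix ι ι ℝ) (d : ι → ℝ), (∀ i, 0 < d i) ∧ L.det ≠ 0 ∧ L.transpose * L = X ∧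
      L * L.transpose = Matrix.diagonal d := by
  obtain ⟨O, hO⟩ : ∃ O : Matrix ι ι ℝ, O = (hX.1.eigenvectorUnitary : Matrix ι ι ℝ) := ⟨_, rfl⟩
  have hO1 : O.transpose * O = 1 := by
    have := Matrix.UnitaryGroup.star_mul_self hX.1.eigenvectorUnitary
    simpa [Matrix.star_eq_conjTranspose, ← hO] using this
  set d := hX.1.eigenvalues with hd
  have hdpos (i : ι) : 0 < d i := hX.eigenvalues_pos i
  have hspec : X = O * Matrix.diagonal d * O.transpose := by
    have := hX.1.spectral_theorem
    simpa [Unitary.conjStarAlgAut_apply, Matrix.star_eq_conjTranspose, ← hO, ← hd] using this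
  have hss : (Matrix.diagonal fun i => Real.sqrt (d i)) *
      (Matrix.diagonal fun i => Real.sqrt (d i)) = Matrix.diagonal d := by
    rw [Matrix.diagonal_mul_diagonal]
    congr 1
    ext i
    exact Real.mul_self_sqrt (hdpos i).le
  refine ⟨(Matrix.diagonal fun i => Real.sqrt (d i)) * O.transpose, d, hdpos, ?_, ?_, ?_⟩
  · have h1 := congrArg Matrix.det hO1
    rw [Matrix.det_mul, Matrix.det_one] at h1
    rw [Matrix.det_mul, Matrix.det_diagonal]
    exact mul_ne_zero (Finset.prod_ne_zero_iff.2 fun i _ => (Real.sqrt_pos.2 (hdpos i)).ne')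
      (left_ne_zero_of_mul_eq_one h1)
  · rw [Matrix.transpose_mul, Matrix.transpose_transpose, Matrix.diagonal_transpose,
      Matrix.mul_assoc, ← Matrix.mul_assoc (Matrix.diagonal _) (Matrix.diagonal _), hss,
      ← Matrix.mul_assoc, ← hspec]
  · rw [Matrix.transpose_mul, Matrix.transpose_transpose, Matrix.diagonal_transpose,
      Matrix.mul_assoc, ← Matrix.mul_assoc O.transpose, hO1, Matrix.one_mul, hss]

/-- The real form of a diagonal complex matrix. -/
def complexDiagonal (ι : Type*) [Fintype ι] [DecidableEq ι] :
    (ι → ℂ) →+* Matrix (ι ⊕ ι) (ι ⊕ ι) ℝ where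
  toFun u := Matrix.fromBlocks (Matrix.diagonal fun i => (u i).re)
    (Matrix.diagonal fun i => (u i).im) (-Matrix.diagonal fun i => (u i).im)
    (Matrix.diagonal fun i => (u i).re)
  map_one' := by simp [← Matrix.fromBlocks_one]
  map_mul' u v := by
    rw [Matrix.fromBlocks_multiply]
    simp only [Matrix.diagonal_mul_diagonal, Matrix.diagonal_neg, Matrix.diagonal_add]
    congr 1 <;> (congr 1; ext i; simp [sub_eq_add_neg, add_comm])
  map_zero' := by simp
  map_add' u v := by
    rw [Matrix.fromBlocks_add]
    simp only [Matrix.diagonal_neg, Matrix.diagonal_add]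
    congr 1
    congr 1
    ext i
    simp [add_comm]

/-- The generator is the image of the vector i t d under the continuous ring homomorphism
`complexDiagonal`, which commutes with exponentials; Euler's formula does the rest. -/
theorem exp_smul_rotation_generator (d : ι → ℝ) (t : ℝ) :
    NormedSpace.exp (t • Matrix.fromBlocks 0 (Matrix.diagonal d) (-Matrix.diagonal d) 0)
      = rotationMatrix fun i => t * d i := by
  have hc : Continuous (complexDiagonal ι) := by
    change Continuous fun u : ι → ℂ => Matrix.fromBlocks (Matrix.diagonal fun i => (u i).re)
      (Matrix.diagonal fun i => (u i).im) (-Matrix.diagonal fun i => (u i).im)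
      (Matrix.diagonal fun i => (u i).re)
    fun_prop
  have h1 : t • Matrix.fromBlocks 0 (Matrix.diagonal d) (-Matrix.diagonal d) 0
      = complexDiagonal ι fun i => ((t * d i : ℝ) : ℂ) * Complex.I := by
    simp [complexDiagonal, Matrix.fromBlocks_smul, ← Matrix.diagonal_smul, Pi.smul_def]
  open scoped Matrix.Norms.Operator in
  have h3 (u : ι → ℂ) : complexDiagonal ι (NormedSpace.exp u)
      = NormedSpace.exp (complexDiagonal ι u) := NormedSpace.map_exp (complexDiagonal ι) hc u
  rw [h1, ← h3]
  have h2 : NormedSpace.exp (fun i => ((t * d i : ℝ) : ℂ) * Complex.I)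
      = fun i => Complex.exp (((t * d i : ℝ) : ℂ) * Complex.I) := by
    ext i
    rw [Pi.coe_exp, Complex.exp_eq_exp_ℂ]
  rw [h2]
  simp only [complexDiagonal, rotationMatrix, RingHom.coe_mk, MonoidHom.coe_mk, OneHom.coe_mk,
    Complex.exp_ofReal_mul_I_re, Complex.exp_ofReal_mul_I_im]

theorem canonicalGroup_eq_conj {X Y L : Matrix ι ι ℝ} {d : ι → ℝ} (hX : X.IsSymm) (hY : Y.IsSymm)
    (hL : L.det ≠ 0) (h1 : L.transpose * L = X) (h2 : L * L.transpose = Matrix.diagonal d)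
    (t : ℝ) {R : Matrix.symplecticGroup ι ℝ}
    (hR : (R : Matrix (ι ⊕ ι) (ι ⊕ ι) ℝ) = rotationMatrix fun i => t * d i) :
    canonicalGroup hX hY t =
      ((⟨_, shear_mem hY⟩ : Matrix.symplecticGroup ι ℝ) * ⟨_, dilation_mem hL⟩) * R *
        ((⟨_, shear_mem hY⟩ : Matrix.symplecticGroup ι ℝ) * ⟨_, dilation_mem hL⟩)⁻¹ := by
  set W : Matrix.symplecticGroup ι ℝ :=
    (⟨_, shear_mem hY⟩ : Matrix.symplecticGroup ι ℝ) * ⟨_, dilation_mem hL⟩ with hW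
  have hWc : (W : Matrix (ι ⊕ ι) (ι ⊕ ι) ℝ) =
    Matrix.fromBlocks 1 0 (-Y) 1 * Matrix.fromBlocks L⁻¹ 0 0 L.transpose := rfl
  have hLL : L⁻¹ * L = 1 := Matrix.nonsing_inv_mul _ (Ne.isUnit hL)
  have hLL' : L * L⁻¹ = 1 := Matrix.mul_nonsing_inv _ (Ne.isUnit hL)
  set K : Matrix (ι ⊕ ι) (ι ⊕ ι) ℝ :=
    Matrix.fromBlocks 0 (Matrix.diagonal d) (-Matrix.diagonal d) 0 with hK
  -- In the coordinates W the shear removes Y and the dilation diagonalises X, leaving the generator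
  -- K of rotations with frequencies dᵢ.
  have hcomm : stdJ ι * hamiltonianMatrix X Y * (W : Matrix (ι ⊕ ι) (ι ⊕ ι) ℝ)
      = (W : Matrix (ι ⊕ ι) (ι ⊕ ι) ℝ) * K := by
    rw [hWc, hK, stdJ, hamiltonianMatrix]
    simp only [Matrix.fromBlocks_multiply, Matrix.mul_zero, Matrix.zero_mul, Matrix.one_mul,
      Matrix.mul_one, zero_add, add_zero, Matrix.mul_neg, Matrix.neg_mul, ← h2, ← h1]
    congr 1
    · rw [neg_zero, add_neg_cancel]
    · rw [← Matrix.mul_assoc, hLL, Matrix.one_mul]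
    · have e1 : L.transpose * L * (L.transpose * L) * L⁻¹ = L.transpose * (L * L.transpose) := by
        simp only [Matrix.mul_assoc, hLL', Matrix.mul_one]
      rw [Matrix.add_mul, e1, neg_neg, Matrix.mul_assoc Y]
      abel
    · rw [Matrix.mul_assoc Y, ← Matrix.mul_assoc L⁻¹, hLL, Matrix.one_mul]
  have hdet : IsUnit (W : Matrix (ι ⊕ ι) (ι ⊕ ι) ℝ).det := SymplecticGroup.symplectic_det W.2
  have hM : t • (stdJ ι * hamiltonianMatrix X Y) =
      (W : Matrix (ι ⊕ ι) (ι ⊕ ι) ℝ) * (t • K) * (W : Matrix (ι ⊕ ι) (ι ⊕ ι) ℝ)⁻¹ := by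
    rw [Matrix.mul_smul, Matrix.smul_mul, ← hcomm, Matrix.mul_assoc, Matrix.mul_nonsing_inv _ hdet,
      Matrix.mul_one]
  refine Subtype.ext ?_
  change NormedSpace.exp (t • (stdJ ι * hamiltonianMatrix X Y)) = _
  rw [Submonoid.coe_mul, Submonoid.coe_mul, SymplecticGroup.coe_inv', hR, hM,
    Matrix.exp_conj _ _ ((Matrix.isUnit_iff_isUnit_det _).2 hdet), hK,
    exp_smul_rotation_generator]

/-! ### The Gaussian as an eigenvector of the lifted canonical group -/

theorem canonicalGroup_add {X Y : Matrix ι ι ℝ} (hX : X.IsSymm) (hY : Y.IsSymm) (s t : ℝ) :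
    canonicalGroup hX hY (s + t) = canonicalGroup hX hY s * canonicalGroup hX hY t := by
  ext1
  change NormedSpace.exp ((s + t) • (stdJ ι * hamiltonianMatrix X Y)) =
    NormedSpace.exp (s • (stdJ ι * hamiltonianMatrix X Y)) *
      NormedSpace.exp (t • (stdJ ι * hamiltonianMatrix X Y))
  rw [add_smul, Matrix.exp_add_of_commute]
  exact ((Commute.refl _).smul_left s).smul_right t

theorem gaussianFun_constant_ne_zero {ħ : ℝ} (hħ : 0 < ħ) {X : Matrix ι ι ℝ} (hX : X.PosDef) :
    (((X.det / (Real.pi * ħ) ^ Fintype.card ι) ^ (1 / 4 : ℝ) : ℝ) : ℂ) ≠ 0 := by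
  have h1 := hX.det_pos
  have : 0 < (X.det / (Real.pi * ħ) ^ Fintype.card ι) ^ (1 / 4 : ℝ) := by positivity
  exact_mod_cast this.ne'

theorem coeFn_gaussian {ħ : ℝ} (hħ : 0 < ħ) {X : Matrix ι ι ℝ} (hX : X.PosDef)
    (Y : Matrix ι ι ℝ) : gaussian hħ hX Y =ᵐ[volume] gaussianFun ħ X Y :=
  (memLp_gaussianFun hħ hX Y).coeFn_toLp

theorem gaussian_ae_ne_zero {ħ : ℝ} (hħ : 0 < ħ) {X : Matrix ι ι ℝ} (hX : X.PosDef)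
    (Y : Matrix ι ι ℝ) : ∀ᵐ x, gaussian hħ hX Y x ≠ 0 := by
  filter_upwards [coeFn_gaussian hħ hX Y] with x hx
  rw [hx, gaussianFun]
  exact mul_ne_zero (gaussianFun_constant_ne_zero hħ hX) (Complex.exp_ne_zero _)

/-- A shear and a dilation turn the standard Gaussian into a multiple of a general one. -/
theorem shear_dilation_gaussian {ħ : ℝ} (hħ : 0 < ħ) {X Y L : Matrix ι ι ℝ} (hX : X.PosDef)
    (hL : L.det ≠ 0) (hLX : L.transpose * L = X) {m : ℤ} {V M : Unitaries ι}
    (hV : IsVHat ħ Y V) (hM : IsMHat L m M) {f : L2 ι}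
    (hf : f =ᵐ[volume] diagGaussian 1 fun _ => 1 / (2 * ħ)) :
    ∃ c : ℂ, c ≠ 0 ∧ (V * M) f = c • gaussian hħ hX Y := by
  refine ⟨Complex.I ^ m * ((Real.sqrt |L.det| : ℝ) : ℂ) /
    (((X.det / (Real.pi * ħ) ^ Fintype.card ι) ^ (1 / 4 : ℝ) : ℝ) : ℂ), ?_, ?_⟩
  · refine div_ne_zero (mul_ne_zero (zpow_ne_zero _ Complex.I_ne_zero) ?_)
      (gaussianFun_constant_ne_zero hħ hX)
    have : 0 < Real.sqrt |L.det| := by positivity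
    exact_mod_cast this.ne'
  · refine Lp.ext ?_
    filter_upwards [hV (M f), hM f, (quasiMeasurePreserving_act hL).ae hf,
      Lp.coeFn_smul (Complex.I ^ m * ((Real.sqrt |L.det| : ℝ) : ℂ) /
        (((X.det / (Real.pi * ħ) ^ Fintype.card ι) ^ (1 / 4 : ℝ) : ℝ) : ℂ)) (gaussian hħ hX Y),
      coeFn_gaussian hħ hX Y] with x h1 h2 h3 h4 h5
    -- |Lx|² = LᵀL x·x = Xx·x.
    have h6 : ∑ i, ((1 / (2 * ħ) : ℂ)) * ((act L x i : ℝ) : ℂ) ^ 2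
        = 1 / (2 * ħ) * ((inner ℝ (act X x) x : ℝ) : ℂ) := by
      rw [← Finset.mul_sum, ← hLX, ← act_act, inner_act_transpose, PiLp.inner_apply]
      simp [sq]
    rw [unitary_mul_apply, h1, h2, h3, h4, Pi.smul_apply, h5, gaussianFun, diagGaussian, h6,
      smul_eq_mul, ← mul_assoc (_ / _), div_mul_cancel₀ _ (gaussianFun_constant_ne_zero hħ hX),
      one_mul, mul_left_comm, ← Complex.exp_add]
    congr 2
    ring

/-- Conjugate the metaplectic rotation by V̂_Y M̂_{L,m}: the eigenvalue is unchanged and the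
eigenvector becomes the Gaussian. -/
theorem exists_covers_canonicalGroup_of_small {ħ : ℝ} (hħ : 0 < ħ) {X Y : Matrix ι ι ℝ}
    (hX : X.PosDef) (hXs : X.IsSymm) (hY : Y.IsSymm) :
    ∃ (τ ε : ℝ), 0 < ε ∧ ∀ t, 0 < t → t < ε → ∃ U : Unitaries ι,
      Covers ħ U (canonicalGroup hXs hY t) ∧
      U (gaussian hħ hX Y) = Complex.exp (-(Complex.I / 2) * ((t * τ : ℝ) : ℂ)) •
        gaussian hħ hX Y := by
  obtain ⟨L, d, hd, hL, hLX, hLd⟩ := exists_transpose_mul_self hX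
  obtain ⟨m, hm⟩ : ∃ m : ℤ, 0 < (-1 : ℝ) ^ m * L.det := by
    rcases lt_or_gt_of_ne hL with h | h
    · exact ⟨1, by simpa using h⟩
    · exact ⟨0, by simpa using h⟩
  obtain ⟨V, hV⟩ := exists_isVHat ħ Y
  obtain ⟨M, hM⟩ := exists_isMHat hL m
  have hb : ∀ i : ι, 0 < ((fun _ => 1 / (2 * ħ) : ι → ℂ) i).re := fun _ => by
    have : (1 / (2 * ħ) : ℂ) = ((1 / (2 * ħ) : ℝ) : ℂ) := by push_cast; rfl
    rw [this, Complex.ofReal_re]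
    positivity
  have hf := (memLp_diagGaussian 1 hb).coeFn_toLp
  set f : L2 ι := (memLp_diagGaussian 1 hb).toLp _
  obtain ⟨c, hc, hW⟩ := shear_dilation_gaussian hħ hX hL hLX hV hM hf
  have hsum : 0 ≤ ∑ i, d i := Finset.sum_nonneg fun i _ => (hd i).le
  -- For t below this bound every angle t dᵢ is less than π; the summand 1 keeps the denominator
  -- positive even when n = 0.
  refine ⟨∑ i, d i, Real.pi / (1 + ∑ i, d i), by positivity, fun t ht htε => ?_⟩
  have hπ (i : ι) : t * d i < Real.pi := by
    rw [lt_div_iff₀ (by positivity)] at htε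
    have h1 : d i ≤ ∑ i, d i := Finset.single_le_sum (fun i _ => (hd i).le) (Finset.mem_univ i)
    nlinarith
  obtain ⟨U, R, hU, hR, hUf⟩ :=
    exists_covers_rotation hħ (θ := fun i => t * d i) (fun i => mul_pos ht (hd i)) hπ hf
  refine ⟨(V * M) * U * (V * M)⁻¹, ?_, ?_⟩
  · rw [canonicalGroup_eq_conj hXs hY hL hLX hLd t hR]
    have hWc := (hV.covers hY).mul (hM.covers ħ hm hL)
    exact (hWc.mul hU).mul hWc.inv
  · have h1 : (V * M)⁻¹ (gaussian hħ hX Y) = c⁻¹ • f := by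
      have h2 : gaussian hħ hX Y = (V * M) (c⁻¹ • f) := by
        rw [map_smul, hW, inv_smul_smul₀ hc]
      rw [h2, ← unitary_mul_apply, inv_mul_cancel, unitary_one_apply]
    rw [unitary_mul_apply, h1, unitary_mul_apply, map_smul, map_smul, hUf, map_smul, hW,
      smul_comm, inv_smul_smul₀ hc]
    congr 3
    push_cast
    rw [Finset.mul_sum]

theorem exists_covers_canonicalGroup {ħ : ℝ} (hħ : 0 < ħ) {X Y : Matrix ι ι ℝ}
    (hX : X.PosDef) (hXs : X.IsSymm) (hY : Y.IsSymm) :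
    ∃ τ : ℝ, ∀ t : ℝ, ∃ U : Unitaries ι, Covers ħ U (canonicalGroup hXs hY t) ∧
      U (gaussian hħ hX Y) = Complex.exp (-(Complex.I / 2) * ((t * τ : ℝ) : ℂ)) •
        gaussian hħ hX Y := by
  obtain ⟨τ, ε, hε, h⟩ := exists_covers_canonicalGroup_of_small hħ hX hXs hY
  -- Both the covering and the prescribed eigenvalue are multiplicative in t, so the admissible
  -- times form a subgroup; containing (0, ε), it is all of ℝ.
  let A : AddSubgroup ℝ :=
    { carrier := {t | ∃ U : Unitaries ι, Covers ħ U (canonicalGroup hXs hY t) ∧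
        U (gaussian hħ hX Y) = Complex.exp (-(Complex.I / 2) * ((t * τ : ℝ) : ℂ)) •
          gaussian hħ hX Y}
      add_mem' := by
        rintro s t ⟨U, hU, hUg⟩ ⟨V, hV, hVg⟩
        refine ⟨U * V, ?_, ?_⟩
        · rw [canonicalGroup_add]
          exact hU.mul hV
        · rw [unitary_mul_apply, hVg, map_smul, hUg, smul_smul, ← Complex.exp_add]
          congr 2
          push_cast
          ring
      zero_mem' := by
        refine ⟨1, ?_, ?_⟩
        · rw [canonicalGroup_zero]
          exact Covers.one ħ
        · simp [unitary_one_apply]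
      neg_mem' := by
        rintro t ⟨U, hU, hUg⟩
        refine ⟨U⁻¹, ?_, ?_⟩
        · have h1 : canonicalGroup hXs hY (-t) = (canonicalGroup hXs hY t)⁻¹ := by
            rw [eq_inv_iff_mul_eq_one, ← canonicalGroup_add, neg_add_cancel, canonicalGroup_zero]
          rw [h1]
          exact hU.inv
        · have h2 : gaussian hħ hX Y = U (Complex.exp (-(Complex.I / 2) * ((-t * τ : ℝ) : ℂ)) •
              gaussian hħ hX Y) := by
            rw [map_smul, hUg, smul_smul, ← Complex.exp_add]
            simp
          conv_lhs => rw [h2]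
          rw [← unitary_mul_apply, inv_mul_cancel, unitary_one_apply] }
  have hpos : ∀ t : ℝ, 0 < t → t ∈ A := fun t ht => by
    obtain ⟨k, hk⟩ := exists_nat_gt (t / ε)
    have hk0 : (0 : ℝ) < k := (div_pos ht hε).trans hk
    have h1 : t / k ∈ A := h _ (by positivity) (by rwa [div_lt_comm₀ hk0 hε])
    have h2 := A.nsmul_mem h1 k
    rwa [nsmul_eq_mul, mul_div_cancel₀ _ hk0.ne'] at h2
  refine ⟨τ, fun t => ?_⟩
  change t ∈ A
  rcases lt_trichotomy t 0 with ht | ht | ht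
  · rw [← neg_neg t]
    exact A.neg_mem (hpos _ (neg_pos.2 ht))
  · rw [ht]; exact A.zero_mem
  · exact hpos t ht

/-- Fixing the eigenvalue leaves one operator for each time, so the choice is automatically a
homomorphism. On displaced Gaussians the action is an explicit phase times a displacement along the
flow, which is continuous; totality extends this to L². -/
theorem exists_isMetaplecticLift {ħ : ℝ} (hħ : 0 < ħ) {X Y : Matrix ι ι ℝ}
    (hX : X.PosDef) (hXs : X.IsSymm) (hY : Y.IsSymm) :
    ∃ (τ : ℝ) (Shat : ℝ → Unitaries ι), IsMetaplecticLift ħ (canonicalGroup hXs hY) Shat ∧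
      ∀ t, Shat t (gaussian hħ hX Y) =
        Complex.exp (-(Complex.I / 2) * ((t * τ : ℝ) : ℂ)) • gaussian hħ hX Y := by
  obtain ⟨τ, h⟩ := exists_covers_canonicalGroup hħ hX hXs hY
  choose Shat hcov hg using h
  refine ⟨τ, Shat, ⟨fun t => ⟨_, hcov t, rfl⟩, hcov, fun s t => ?_, ?_⟩, hg⟩
  · refine (hcov (s + t)).unique hħ.ne' (canonicalGroup_add hXs hY s t ▸ (hcov s).mul (hcov t))
      (gaussian_ae_ne_zero hħ hX Y) ?_
    rw [hg, unitary_mul_apply, hg, map_smul, hg, smul_smul, ← Complex.exp_add]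
    congr 2
    push_cast
    ring
  · refine continuous_unitary_of_total
      (topologicalClosure_span_displace hħ.ne' (gaussian_ae_ne_zero hħ hX Y)) ?_
    rintro _ ⟨z, rfl⟩
    have h1 (t : ℝ) : Shat t (displace ħ z (gaussian hħ hX Y)) =
        Complex.exp (-(Complex.I / 2) * ((t * τ : ℝ) : ℂ)) •
          displace ħ (act (canonicalGroup hXs hY t : Matrix (ι ⊕ ι) (ι ⊕ ι) ℝ) z)
            (gaussian hħ hX Y) := by
      rw [(hcov t).apply_displace, hg, displace_smul]
    have h2 : Continuous fun t =>
        act (canonicalGroup hXs hY t : Matrix (ι ⊕ ι) (ι ⊕ ι) ℝ) z :=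
      continuous_iff_continuousAt.2 fun t =>
        (hasDerivAt_canonicalGroup hXs hY z t).continuousAt
    simp_rw [h1]
    have h3 : Continuous fun t : ℝ => Complex.exp (-(Complex.I / 2) * ((t * τ : ℝ) : ℂ)) := by
      fun_prop
    exact h3.smul ((continuous_displace ħ _).comp h2)

/-- Every metaplectic lift of the canonical group has the Gaussian as an eigenvector. -/
theorem IsMetaplecticLift.apply_gaussian {ħ : ℝ} (hħ : 0 < ħ) {X Y : Matrix ι ι ℝ}
    (hX : X.PosDef) (hXs : X.IsSymm) (hY : Y.IsSymm) {Shat : ℝ → Unitaries ι}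
    (hS : IsMetaplecticLift ħ (canonicalGroup hXs hY) Shat) (t : ℝ) :
    ∃ c : ℂ, ‖c‖ = 1 ∧ Shat t (gaussian hħ hX Y) = c • gaussian hħ hX Y := by
  obtain ⟨τ, T, hT, hTg⟩ := exists_isMetaplecticLift hħ hX hXs hY
  -- At time t both lifts cover the same matrix, so their values on the Gaussian differ by a phase.
  obtain ⟨c, hc, h⟩ := (hT.covers t).exists_smul_eq hħ.ne' (hS.covers t) (gaussian hħ hX Y)
  have hn : ‖Complex.exp (-(Complex.I / 2) * ((t * τ : ℝ) : ℂ))‖ = 1 := by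
    have : -(Complex.I / 2) * ((t * τ : ℝ) : ℂ) = ((-(t * τ / 2) : ℝ) : ℂ) * Complex.I := by
      push_cast; ring
    rw [this, Complex.norm_exp_ofReal_mul_I]
  refine ⟨c * Complex.exp (-(Complex.I / 2) * ((t * τ : ℝ) : ℂ)), by rw [norm_mul, hc, hn, one_mul],
    ?_⟩
  rw [h, hTg, smul_smul]

/-! ### Symplectic covariance of Toeplitz operators -/

/-- The phase c enters linearly through the vector and conjugated through the coefficient, so it
cancels; S preserves volume. -/
theorem toeplitz_covariance {ħ : ℝ} {U : Unitaries ι} {S : Matrix.symplecticGroup ι ℝ}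
    (hU : Covers ħ U S) {φ : L2 ι} {c : ℂ} (hc : ‖c‖ = 1) (hφ : U φ = c • φ)
    (a : Phase ι → ℂ) (ψ : L2 ι) :
    U (toeplitz ħ φ (symbolComp a S) (U⁻¹ ψ)) = toeplitz ħ φ a ψ := by
  have hcc : c * (starRingEnd ℂ) c = 1 := by
    rw [Complex.mul_conj, Complex.normSq_eq_norm_sq, hc]; simp
  have hmp := measurePreserving_act (SymplecticGroup.det_eq_one S.2)
  have hdet : (S : Matrix (ι ⊕ ι) (ι ⊕ ι) ℝ).det ≠ 0 := by
    rw [SymplecticGroup.det_eq_one S.2]; exact one_ne_zero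
  have hemb : MeasurableEmbedding (act (S : Matrix (ι ⊕ ι) (ι ⊕ ι) ℝ)) :=
    (actEquiv _ hdet).measurableEmbedding
  have hpt (z : Phase ι) : U (toeplitzIntegrand ħ φ (symbolComp a S) (U⁻¹ ψ) z) =
      toeplitzIntegrand ħ φ a ψ (act (S : Matrix (ι ⊕ ι) (ι ⊕ ι) ℝ) z) := by
    have h1 : (inner ℂ (displace ħ z φ) (U⁻¹ ψ) : ℂ) = inner ℂ (U (displace ħ z φ)) ψ := by
      rw [← U.inner_map_map, ← unitary_mul_apply, mul_inv_cancel, unitary_one_apply]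
    rw [toeplitzIntegrand, toeplitzIntegrand, map_smul, h1, hU.apply_displace, hφ, displace_smul,
      inner_smul_left, smul_smul, symbolComp]
    congr 1
    linear_combination (a (act (S : Matrix (ι ⊕ ι) (ι ⊕ ι) ℝ) z) *
      inner ℂ (displace ħ (act (S : Matrix (ι ⊕ ι) (ι ⊕ ι) ℝ) z) φ) ψ) * hcc
  have h2 : U (∫ z, toeplitzIntegrand ħ φ (symbolComp a S) (U⁻¹ ψ) z) =
      ∫ z, toeplitzIntegrand ħ φ a ψ z := by
    rw [← hmp.integral_comp hemb (toeplitzIntegrand ħ φ a ψ), ← integral_congr_ae (Filter.Eventually.of_forall hpt)]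
    -- A continuous linear equivalence commutes with the Bochner integral whether or not the
    -- integrand is integrable.
    exact (U.toContinuousLinearEquiv.integral_comp_comm _).symm
  rw [toeplitz, toeplitz, ← h2]
  exact map_smul (U.toLinearEquiv.restrictScalars ℝ) _ _

/-! ### Symplectic invariance of the Feichtinger algebra -/

/-- Substituting Ay for y transfers A to the position, and its inverse transpose to the momentum;
there is no Jacobian factor because det A = 1. -/
theorem wigner_comp_act {κ : Type*} [Fintype κ] [DecidableEq κ] (ħ : ℝ) {A : Matrix κ κ ℝ}
    (hA : A.det = 1) (a : EuclideanSpace ℝ κ → ℂ) (z : EuclideanSpace ℝ (κ ⊕ κ)) :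
    wigner ħ (fun x => a (act A x)) z =
      wigner ħ a (act (Matrix.fromBlocks A 0 0 A⁻¹.transpose) z) := by
  have hdet : A.det ≠ 0 := by rw [hA]; exact one_ne_zero
  rw [wigner, wigner, act_fromBlocks, pos_phasePoint, mom_phasePoint, act_zero, act_zero, add_zero,
    zero_add]
  conv_rhs => rw [← (measurePreserving_act hA).integral_comp (actEquiv A hdet).measurableEmbedding]
  congr 1
  refine integral_congr_ae (Filter.Eventually.of_forall fun y => ?_)
  simp only [inner_act_transpose, act_act, Matrix.nonsing_inv_mul _ (Ne.isUnit hdet), act_one,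
    act_add, act_sub, act_smul]

theorem MemFeichtinger.comp_act {κ : Type*} [Fintype κ] [DecidableEq κ] {ħ : ℝ}
    {a : EuclideanSpace ℝ κ → ℂ} (ha : MemFeichtinger ħ a) {A : Matrix κ κ ℝ} (hA : A.det = 1) :
    MemFeichtinger ħ fun x => a (act A x) := by
  refine ⟨ha.1.comp_measurePreserving (measurePreserving_act hA), ?_⟩
  -- The induced map on the doubled space also has determinant one, so it preserves the L¹ condition
  -- on the Wigner transform.
  have h1 : (Matrix.fromBlocks A 0 0 A⁻¹.transpose).det = 1 := by
    rw [Matrix.det_fromBlocks_zero₂₁, Matrix.det_transpose, Matrix.det_nonsing_inv, hA]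
    simp
  have h2 : wigner ħ (fun x => a (act A x)) =
      wigner ħ a ∘ act (Matrix.fromBlocks A 0 0 A⁻¹.transpose) :=
    funext fun z => wigner_comp_act ħ hA a z
  rw [h2]
  exact (measurePreserving_act h1).integrable_comp_of_integrable ha.2

end

end BlobQuantization

/-! ### The covariance theorem for blob operators. -/

open BlobQuantization in
theorem mainTheorem5 (n : ℕ) (ħ : ℝ) (hħ : 0 < ħ) (X Y : Matrix (Fin n) (Fin n) ℝ)
    (hX : X.PosDef) (hXs : X.IsSymm) (hY : Y.IsSymm) :
    (∃ Shat : ℝ → Unitaries (Fin n), IsMetaplecticLift ħ (canonicalGroup hXs hY) Shat) ∧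
    ∀ Shat : ℝ → Unitaries (Fin n), IsMetaplecticLift ħ (canonicalGroup hXs hY) Shat →
      ∀ a : Phase (Fin n) → ℂ, MemFeichtinger ħ a → ∀ t : ℝ,
        MemFeichtinger ħ (symbolComp a (canonicalGroup hXs hY t)) ∧
        (∀ ψ : L2 (Fin n), Integrable (toeplitzIntegrand ħ (gaussian hħ hX Y) a ψ) volume) ∧
        (∀ ψ : L2 (Fin n), Integrable (toeplitzIntegrand ħ (gaussian hħ hX Y)
          (symbolComp a (canonicalGroup hXs hY t)) ψ) volume) ∧
        ∀ ψ : L2 (Fin n), toeplitz ħ (gaussian hħ hX Y) a ψ =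
          Shat t (toeplitz ħ (gaussian hħ hX Y) (symbolComp a (canonicalGroup hXs hY t))
            (Shat (-t) ψ)) := by
  refine ⟨?_, fun Shat hS a ha t => ?_⟩
  · obtain ⟨_, Shat, hS, _⟩ := exists_isMetaplecticLift hħ hX hXs hY
    exact ⟨Shat, hS⟩
  have hac : MemFeichtinger ħ (symbolComp a (canonicalGroup hXs hY t)) :=
    ha.comp_act (SymplecticGroup.det_eq_one (canonicalGroup hXs hY t).2)
  refine ⟨hac, integrable_toeplitzIntegrand hħ.ne' _ ha.1,
    integrable_toeplitzIntegrand hħ.ne' _ hac.1, fun ψ => ?_⟩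
  obtain ⟨c, hc, hg⟩ := hS.apply_gaussian hħ hX hXs hY t
  -- The group law forces the value 1 at time zero, so Ŝ_{-t} is the inverse required by
  -- `toeplitz_covariance`.
  have h0 : Shat 0 = 1 := by
    have h := hS.map_add 0 0
    rwa [add_zero, left_eq_mul] at h
  have hneg : Shat (-t) = (Shat t)⁻¹ := by
    rw [eq_inv_iff_mul_eq_one, ← hS.map_add, neg_add_cancel, h0]
  rw [hneg, toeplitz_covariance (hS.covers t) hc hg]
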